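/- Let $n\ge 1$, let $\Omega\subset\mathbb R^n$ be a bounded open set with Lipschitz boundary $\Sigma=\partial\Omega$, and let $\beta\in L^\infty(\Sigma)$ (with respect to the $(n-1)$-dimensional surface measure $ds$). For $v\in L^1(\Omega)$ put $$\int_\Omega\sqrt{1+|Dv|^2}=\sup_g\int_\Omega \Big(g_{n+1}+v\sum_{i=1}^n D_ig_i\Big)\,dx,\qquad \int_\Omega\sqrt{v^2+|Dv|^2}=\sup_g\int_\Omega v\Big(g_{n+1}+\sum_{i=1}^n D_ig_i\Big)\,dx,$$ where the suprema run over all $g=(g_1,\dots,g_{n+1})$ whose components are $C^1$ with compact support in $\Omega$ and satisfy $\sum_{i=1}^{n+1}g_i^2\le 1$. Let $BV(\Omega)=\{v\in L^1(\Omega):\int_\Omega\sqrt{1+|Dv|^2}<\infty\}$ and $BV^+(\Omega)=\{v\in BV(\Omega): v\ge 0\text{ a.e.}\}$. For $v\in BV^+(\Omega)$ define $$\mathcal J_1(v)=\int_\Omega\sqrt{v^2+|Dv|^2}+\int_\Omega\int_1^{v}\ln h\,dh\,dx-\int_\Sigma\beta\,(1-v)\,ds,$$ where in the last integral $v$ denotes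 the trace of $v$ on $\Sigma$, i.e. the function whose value at ($ds$-almost every) $x\in\Sigma$ is the number $c$ such that the mean of $|v-c|$ over $B_r(x)\cap\Omega$ tends to $0$ as $r\to0^+$. Suppose that $\beta\le 0$ almost everywhere on $\Sigma$ and that $v\in BV^+(\Omega)$ minimises $\mathcal J_1$ in $BV^+(\Omega)$, that is, $\mathcal J_1(v)\le\mathcal J_1(w)$ for all $w\in BV^+(\Omega)$. Then $v\ge e^{-1}$ almost everywhere in $\Omega$. -/

import Mathlib

open MeasureTheory Set Filter Topology
open scoped ENNReal

noncomputable section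

namespace Capillarity

/-- Euclidean space `ℝⁿ`. -/
abbrev E (n : ℕ) : Type := EuclideanSpace ℝ (Fin n)

/-- `Ω` has Lipschitz boundary: near each boundary point, after a rigid motion, `Ω` is the region
strictly below the graph of a Lipschitz function of the `n - 1` variables orthogonal to a unit
vector `e`. -/
def HasLipschitzBoundary {n : ℕ} (Ω : Set (E n)) : Prop :=
  ∀ p ∈ frontier Ω, ∃ r : ℝ, 0 < r ∧ ∃ e : E n, ‖e‖ = 1 ∧
    ∃ (K : NNReal) (γ : (ℝ ∙ e)ᗮ → ℝ), LipschitzWith K γ ∧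
      ∀ x ∈ Metric.ball p r,
        (x ∈ Ω ↔ inner ℝ e x < γ ((ℝ ∙ e)ᗮ.orthogonalProjectionOnto x))

/-- Admissible test fields `g = (g₁, …, g_{n+1})`: every component is `C¹` with compact support
in `Ω`, and `∑ gᵢ² ≤ 1` pointwise. -/
def testFields {n : ℕ} (Ω : Set (E n)) : Set (Fin (n + 1) → E n → ℝ) :=
  {g | (∀ i, ContDiff ℝ 1 (g i) ∧ HasCompactSupport (g i) ∧ tsupport (g i) ⊆ Ω) ∧
    ∀ x, ∑ i, (g i x) ^ 2 ≤ 1}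

/-- The divergence `div_n g = ∑_{i ≤ n} Dᵢ gᵢ` of the first `n` components of `g`. -/
def divn {n : ℕ} (g : Fin (n + 1) → E n → ℝ) (x : E n) : ℝ :=
  ∑ i : Fin n, fderiv ℝ (g i.castSucc) x (EuclideanSpace.single i 1)

/-- `∫_Ω √(1 + |Dv|²)`, as the supremum of `∫_Ω g_{n+1} + v div_n g` over test fields. -/
def areaOne {n : ℕ} (Ω : Set (E n)) (v : E n → ℝ) : EReal :=
  ⨆ g ∈ testFields Ω, ((∫ x in Ω, (g (Fin.last n) x + v x * divn g x) : ℝ) : EReal)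

/-- `∫_Ω √(v² + |Dv|²)`, as the supremum of `∫_Ω v (g_{n+1} + div_n g)` over test fields. -/
def surfaceEnergy {n : ℕ} (Ω : Set (E n)) (v : E n → ℝ) : EReal :=
  ⨆ g ∈ testFields Ω, ((∫ x in Ω, v x * (g (Fin.last n) x + divn g x) : ℝ) : EReal)

/-- `BV(Ω)`. -/
def BV {n : ℕ} (Ω : Set (E n)) : Set (E n → ℝ) :=
  {v | IntegrableOn v Ω ∧ areaOne Ω v < ⊤}

/-- `BV⁺(Ω)`: the almost everywhere nonnegative elements of `BV(Ω)`. -/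
def BVplus {n : ℕ} (Ω : Set (E n)) : Set (E n → ℝ) :=
  {v | v ∈ BV Ω ∧ ∀ᵐ x ∂(volume.restrict Ω), 0 ≤ v x}

/-- The number `c` is the trace of `v` at the boundary point `x`: the mean of `|v - c|` over
`B_r(x) ∩ Ω` tends to `0` as `r → 0⁺`. -/
def IsTraceAt {n : ℕ} (Ω : Set (E n)) (v : E n → ℝ) (x : E n) (c : ℝ) : Prop :=
  Tendsto (fun r : ℝ => ⨍ y in Metric.ball x r ∩ Ω, |v y - c|) (𝓝[>] 0) (𝓝 0)

/-- The trace value of an integrable function at a boundary point of an open set is unique. -/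
theorem IsTraceAt.unique {n : ℕ} {Ω : Set (E n)} (hΩ : IsOpen Ω) {v : E n → ℝ}
    (hv : IntegrableOn v Ω) {x : E n} (hx : x ∈ frontier Ω) {c d : ℝ}
    (hc : IsTraceAt Ω v x c) (hd : IsTraceAt Ω v x d) : c = d := by
  have hsum := hc.add hd
  rw [add_zero] at hsum
  have hle : |c - d| ≤ 0 := by
    refine ge_of_tendsto hsum ?_
    filter_upwards [self_mem_nhdsWithin] with r hr
    have hr : 0 < r := hr
    have hopen : IsOpen (Metric.ball x r ∩ Ω) := Metric.isOpen_ball.inter hΩ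
    have hne : (Metric.ball x r ∩ Ω).Nonempty :=
      mem_closure_iff.1 (frontier_subset_closure hx) _ Metric.isOpen_ball
        (Metric.mem_ball_self hr)
    have hpos : volume (Metric.ball x r ∩ Ω) ≠ 0 := (hopen.measure_pos _ hne).ne'
    have hfin : volume (Metric.ball x r ∩ Ω) ≠ ⊤ :=
      ((measure_mono inter_subset_left).trans_lt measure_ball_lt_top).ne
    have hvi : IntegrableOn v (Metric.ball x r ∩ Ω) := hv.mono_set inter_subset_right
    have hi : ∀ a : ℝ, IntegrableOn (fun y => |v y - a|) (Metric.ball x r ∩ Ω) := fun a =>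
      (hvi.sub (integrableOn_const hfin)).abs
    have hint : (∫ _ in Metric.ball x r ∩ Ω, |c - d|) ≤
        ∫ y in Metric.ball x r ∩ Ω, (|v y - c| + |v y - d|) := by
      refine integral_mono (integrableOn_const hfin) ((hi c).add (hi d)) fun y => ?_
      have := abs_sub_le c (v y) d
      rwa [abs_sub_comm c (v y)] at this
    rw [integral_add (hi c) (hi d)] at hint
    have key : |c - d| = ⨍ _ in Metric.ball x r ∩ Ω, |c - d| :=
      (setAverage_const hpos hfin _).symm
    rw [key, setAverage_eq, setAverage_eq, setAverage_eq, ← smul_add]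
    exact smul_le_smul_of_nonneg_left hint (inv_nonneg.2 measureReal_nonneg)
  exact sub_eq_zero.1 (abs_nonpos_iff.1 hle)

open Classical in
/-- The boundary trace of `v` (with value `0` at points where `v` has no trace; for `v ∈ BV(Ω)`
and `Ω` bounded with Lipschitz boundary, these form a null set for the surface measure). -/
def trace {n : ℕ} (Ω : Set (E n)) (v : E n → ℝ) (x : E n) : ℝ :=
  if h : ∃ c, IsTraceAt Ω v x c then h.choose else 0

/-- Surface measure on `Σ = ∂Ω`: `(n-1)`-dimensional Hausdorff measure, with the Euclidean
normalisation. -/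
def surfaceMeasure {n : ℕ} (Ω : Set (E n)) : Measure (E n) :=
  (Measure.euclideanHausdorffMeasure (n - 1)).restrict (frontier Ω)

/-- The potential energy `∫_Ω ∫_1^v ln h dh dx`; for `v ≥ 0` the inner integral is nonnegative, so
the outer one is well defined in `[0, ∞]`. -/
def potentialEnergy {n : ℕ} (Ω : Set (E n)) (v : E n → ℝ) : ℝ≥0∞ :=
  ∫⁻ x in Ω, ENNReal.ofReal (∫ h in (1 : ℝ)..(v x), Real.log h)

/-- The wetting energy `-∫_Σ β (1 - v) ds`, with `v` on `Σ` in the sense of traces. -/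
def wettingEnergy {n : ℕ} (Ω : Set (E n)) (β : E n → ℝ) (v : E n → ℝ) : ℝ :=
  -∫ x, β x * (1 - trace Ω v x) ∂(surfaceMeasure Ω)

/-- The energy `J₁`. -/
def J1 {n : ℕ} (Ω : Set (E n)) (β : E n → ℝ) (v : E n → ℝ) : EReal :=
  surfaceEnergy Ω v + (potentialEnergy Ω v : EReal) + (wettingEnergy Ω β v : EReal)

/-- `v` minimises `J₁` in `BV⁺(Ω)`. -/
def IsMinimiser {n : ℕ} (Ω : Set (E n)) (β : E n → ℝ) (v : E n → ℝ) : Prop :=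
  v ∈ BVplus Ω ∧ ∀ w ∈ BVplus Ω, J1 Ω β v ≤ J1 Ω β w

end Capillarity

end

namespace Capillarity

variable {n : ℕ}

/-! Let `c = e⁻¹` and compare `v` with `w = L(v)`, where `L(s) = s + ((c - s)⁺)³ / 6` (`lift`)
raises values below `c` without crossing `c`. If `v < c` on a set of positive measure, then `w` has
strictly smaller energy.

Potential: `F(s) = ∫₁ˢ ln = s ln s - s + 1`, so `F(L) + (L - s) = L ln L - s + 1`. Since `t ln t`
strictly decreases on `[0, e⁻¹]`, the potential falls by more than `∫ (w - v)`
(`potentialEnergy_lift_add_lt`).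

Surface: for smooth `u ≥ 0` the vector `(L, L' Du)` equals `L' (u, Du) + (1 - L') (u, 0) + (L - u,
0)`. As `0 ≤ L' ≤ 1`, its length is at most `√(u² + |Du|²) + (L - u)`, so this term grows by at most
`∫ (w - v)`. The estimate is carried out in dual form on test fields and extended to `v` by
mollification (`integral_lift_mul_fieldDiv_le`).

Wetting: the trace does not decrease and `β ≤ 0`, so this term does not grow
(`wettingEnergy_lift_le`).

The truncation `max v c` would serve formally. The smooth `L` keeps `L'(u) g` of class `C¹`, and its
bi-Lipschitz bounds make `v` and `w` have traces at exactly the same points, so that no trace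
theorem for `BV` is needed. -/

/-! ### The deformation of the values. -/

theorem hasDerivAt_posPart_pow (k : ℕ) (t : ℝ) :
    HasDerivAt (fun s : ℝ => (max s 0) ^ (k + 2)) ((k + 2) * (max t 0) ^ (k + 1)) t := by
  rcases lt_trichotomy t 0 with h | h | h
  · have h1 : (fun s : ℝ => (max s 0) ^ (k + 2)) =ᶠ[𝓝 t] fun _ => 0 := by
      filter_upwards [gt_mem_nhds h] with s hs
      simp [max_eq_right hs.le]
    rw [max_eq_right h.le]
    simpa using (hasDerivAt_const t (0 : ℝ)).congr_of_eventuallyEq h1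
  · subst h
    simp only [max_self]
    rw [hasDerivAt_iff_isLittleO]
    simp only [max_self, sub_zero, smul_eq_mul, ne_eq, Nat.add_eq_zero_iff, one_ne_zero, and_false,
      not_false_eq_true, zero_pow, mul_zero, OfNat.ofNat_ne_zero]
    have h2 : (fun x : ℝ => x ^ (k + 2)) =o[𝓝 0] fun x : ℝ => x :=
      Asymptotics.isLittleO_pow_id (by omega)
    refine Asymptotics.IsBigO.trans_isLittleO ?_ h2
    refine Asymptotics.isBigO_of_le _ fun x => ?_
    rw [norm_pow, norm_pow]
    refine pow_le_pow_left₀ (norm_nonneg _) ?_ _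
    rw [Real.norm_eq_abs, Real.norm_eq_abs, abs_of_nonneg (le_max_right x 0)]
    exact max_le (le_abs_self x) (abs_nonneg x)
  · have h1 : (fun s : ℝ => (max s 0) ^ (k + 2)) =ᶠ[𝓝 t] fun s => s ^ (k + 2) := by
      filter_upwards [lt_mem_nhds h] with s hs
      simp [max_eq_left hs.le]
    rw [max_eq_left h.le]
    simpa using (hasDerivAt_pow (k + 2) t).congr_of_eventuallyEq h1

theorem hasDerivAt_sub_posPart_pow (c : ℝ) (k : ℕ) (s : ℝ) :
    HasDerivAt (fun s : ℝ => (max (c - s) 0) ^ (k + 2))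
      (-((k + 2) * (max (c - s) 0) ^ (k + 1))) s := by
  have := (hasDerivAt_posPart_pow k (c - s)).comp s ((hasDerivAt_id s).const_sub c)
  simpa using! this

theorem contDiff_sub_posPart_pow (c : ℝ) (k : ℕ) :
    ContDiff ℝ 1 (fun s : ℝ => (max (c - s) 0) ^ (k + 2)) := by
  rw [contDiff_one_iff_deriv]
  refine ⟨fun s => (hasDerivAt_sub_posPart_pow c k s).differentiableAt, ?_⟩
  have : deriv (fun s : ℝ => (max (c - s) 0) ^ (k + 2)) =
      fun s => -((k + 2) * (max (c - s) 0) ^ (k + 1)) :=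
    funext fun s => (hasDerivAt_sub_posPart_pow c k s).deriv
  rw [this]
  fun_prop

/-- The increment `((c - s)⁺)³ / 6`. -/
noncomputable def bump (c s : ℝ) : ℝ := (max (c - s) 0) ^ 3 / 6

/-- A `C²` deformation of `ℝ` that moves `[0, c)` upwards and fixes `[c, ∞)`. -/
noncomputable def lift (c s : ℝ) : ℝ := s + bump c s

theorem continuous_bump (c : ℝ) : Continuous (bump c) := by
  unfold bump; fun_prop

theorem bump_nonneg (c s : ℝ) : 0 ≤ bump c s := by
  unfold bump; positivity

theorem bump_eq_zero {c s : ℝ} (h : c ≤ s) : bump c s = 0 := by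
  simp [bump, h]

theorem bump_pos {c s : ℝ} (h : s < c) : 0 < bump c s := by
  have : 0 < c - s := by linarith
  rw [bump, max_eq_left this.le]; positivity

theorem bump_le_one {c s : ℝ} (hc : c ≤ 1) (hs : 0 ≤ s) : bump c s ≤ 1 := by
  unfold bump
  have h1 : max (c - s) 0 ≤ 1 := max_le (by linarith) zero_le_one
  have h2 : (max (c - s) 0) ^ 3 ≤ 1 := pow_le_one₀ (le_max_right _ _) h1
  linarith

theorem abs_bump_le_one {c s : ℝ} (hc : c ≤ 1) (hs : 0 ≤ s) : |bump c s| ≤ 1 := by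
  rw [abs_of_nonneg (bump_nonneg c s)]; exact bump_le_one hc hs

/-- Factor `a³ - b³ = (a - b)(a² + ab + b²)` with `0 ≤ b ≤ a ≤ 1`; division by 6 gives the constant
1/2. A constant below 1 is what makes `lift` injective with Lipschitz inverse. -/
theorem bump_sub_le {c s t : ℝ} (hc : c ≤ 1) (hs : 0 ≤ s) (hst : s ≤ t) :
    bump c s - bump c t ≤ (t - s) / 2 := by
  unfold bump
  set a := max (c - s) 0
  set b := max (c - t) 0
  have hb : 0 ≤ b := le_max_right _ _
  have hba : b ≤ a := max_le_max (by linarith) le_rfl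
  have ha1 : a ≤ 1 := max_le (by linarith) zero_le_one
  have hab : a - b ≤ t - s := by
    rcases le_total (c - s) 0 with h | h
    · have : a = 0 := max_eq_right h
      linarith
    · have : a = c - s := max_eq_left h
      have : c - t ≤ b := le_max_left _ _
      linarith
  have h3 : a ^ 2 + a * b + b ^ 2 ≤ 3 := by nlinarith
  nlinarith [mul_le_mul_of_nonneg_left h3 (sub_nonneg.2 hba)]

theorem bump_anti {c s t : ℝ} (hst : s ≤ t) : bump c t ≤ bump c s := by
  unfold bump
  have : max (c - t) 0 ≤ max (c - s) 0 := max_le_max (by linarith) le_rfl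
  have := pow_le_pow_left₀ (le_max_right (c - t) 0) this 3
  linarith

/-- On `[0, ∞)` the deformation `lift` is bi-Lipschitz. -/
theorem lift_bilipschitz {c s t : ℝ} (hc : c ≤ 1) (hs : 0 ≤ s) (ht : 0 ≤ t) :
    |lift c s - lift c t| ≤ |s - t| ∧ |s - t| ≤ 2 * |lift c s - lift c t| := by
  wlog hst : t ≤ s generalizing s t
  · have := this ht hs (le_of_not_ge hst)
    rwa [abs_sub_comm (lift c s), abs_sub_comm s]
  have h1 := bump_sub_le hc ht hst
  have h2 := bump_anti (c := c) hst
  rw [abs_of_nonneg (sub_nonneg.2 hst)]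
  have h3 : 0 ≤ lift c s - lift c t := by unfold lift; linarith
  rw [abs_of_nonneg h3]
  unfold lift
  constructor <;> linarith

theorem lift_le {c s : ℝ} (hc : c ≤ 1) (hs : 0 ≤ s) (hsc : s ≤ c) : lift c s ≤ c := by
  have h := bump_sub_le hc hs hsc
  rw [bump_eq_zero le_rfl] at h
  unfold lift
  linarith

/-! ### The potential density under the deformation. -/

theorem integral_log_one (s : ℝ) :
    (∫ h in (1 : ℝ)..s, Real.log h) = s * Real.log s - s + 1 := by
  rw [integral_log]; simp

theorem integral_log_one_nonneg {s : ℝ} (hs : 0 ≤ s) : 0 ≤ ∫ h in (1 : ℝ)..s, Real.log h := by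
  rw [integral_log_one]
  rcases hs.eq_or_lt with rfl | h
  · simp
  · have h1 := Real.one_sub_inv_le_log_of_pos h
    have h2 := mul_le_mul_of_nonneg_left h1 hs
    rw [mul_sub, mul_inv_cancel₀ h.ne'] at h2
    linarith

/-- Adding the increment cancels the linear term of `s ln s - s + 1`, leaving the strict
monotonicity of `s ln s` on `[0, e⁻¹]`. This is where the threshold `e⁻¹` comes from. -/
theorem integral_log_lift_lt {s : ℝ} (hs : 0 ≤ s) (hsc : s < Real.exp (-1)) :
    (∫ h in (1 : ℝ)..lift (Real.exp (-1)) s, Real.log h) + bump (Real.exp (-1)) s <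
      ∫ h in (1 : ℝ)..s, Real.log h := by
  have hc : Real.exp (-1) ≤ 1 := Real.exp_le_one_iff.2 (by norm_num)
  have h1 := bump_pos hsc
  have h2 := lift_le hc hs hsc.le
  have h3 : s < lift (Real.exp (-1)) s := by unfold lift; linarith
  have h4 := Real.mul_log_strictAntiOn ⟨hs, hsc.le⟩ ⟨hs.trans h3.le, h2⟩ h3
  simp only [integral_log_one]
  simp only at h4
  have h5 : lift (Real.exp (-1)) s = s + bump (Real.exp (-1)) s := rfl
  linarith

theorem integral_log_lift_le {s : ℝ} (hs : 0 ≤ s) :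
    (∫ h in (1 : ℝ)..lift (Real.exp (-1)) s, Real.log h) + bump (Real.exp (-1)) s ≤
      ∫ h in (1 : ℝ)..s, Real.log h := by
  rcases lt_or_ge s (Real.exp (-1)) with h | h
  · exact (integral_log_lift_lt hs h).le
  · simp [lift, bump_eq_zero h]

/-! ### Test fields and their translates. -/

/-- The integrand `g_{n+1} + div_n g` of the surface energy. -/
noncomputable def fieldDiv (g : Fin (n + 1) → E n → ℝ) (x : E n) : ℝ :=
  g (Fin.last n) x + divn g x

/-- The union of the supports of the components of `g`. -/
def fieldSupport (g : Fin (n + 1) → E n → ℝ) : Set (E n) := ⋃ i, tsupport (g i)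

theorem isCompact_fieldSupport {Ω : Set (E n)} {g : Fin (n + 1) → E n → ℝ}
    (hg : g ∈ testFields Ω) : IsCompact (fieldSupport g) :=
  isCompact_iUnion fun i => (hg.1 i).2.1

theorem fieldSupport_subset {Ω : Set (E n)} {g : Fin (n + 1) → E n → ℝ}
    (hg : g ∈ testFields Ω) : fieldSupport g ⊆ Ω :=
  iUnion_subset fun i => (hg.1 i).2.2

theorem eq_zero_of_notMem_fieldSupport {g : Fin (n + 1) → E n → ℝ} {x : E n}
    (hx : x ∉ fieldSupport g) (i : Fin (n + 1)) : g i x = 0 :=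
  image_eq_zero_of_notMem_tsupport fun h => hx (mem_iUnion.2 ⟨i, h⟩)

theorem divn_eq_zero_of_notMem_fieldSupport {g : Fin (n + 1) → E n → ℝ} {x : E n}
    (hx : x ∉ fieldSupport g) : divn g x = 0 := by
  refine Finset.sum_eq_zero fun i _ => ?_
  rw [fderiv_of_notMem_tsupport ℝ fun h => hx (mem_iUnion.2 ⟨_, h⟩)]
  rfl

theorem fieldDiv_eq_zero_of_notMem_fieldSupport {g : Fin (n + 1) → E n → ℝ} {x : E n}
    (hx : x ∉ fieldSupport g) : fieldDiv g x = 0 := by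
  rw [fieldDiv, eq_zero_of_notMem_fieldSupport hx, divn_eq_zero_of_notMem_fieldSupport hx, add_zero]

theorem continuous_divn {g : Fin (n + 1) → E n → ℝ} (hg : ∀ i, ContDiff ℝ 1 (g i)) :
    Continuous (divn g) := by
  unfold divn
  refine continuous_finsetSum _ fun i _ => ?_
  exact ((hg _).continuous_fderiv one_ne_zero).clm_apply continuous_const

theorem continuous_fieldDiv {Ω : Set (E n)} {g : Fin (n + 1) → E n → ℝ}
    (hg : g ∈ testFields Ω) : Continuous (fieldDiv g) :=
  (hg.1 _).1.continuous.add (continuous_divn fun i => (hg.1 i).1)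

theorem hasCompactSupport_fieldDiv {Ω : Set (E n)} {g : Fin (n + 1) → E n → ℝ}
    (hg : g ∈ testFields Ω) : HasCompactSupport (fieldDiv g) :=
  HasCompactSupport.intro (isCompact_fieldSupport hg) fun _ hx =>
    fieldDiv_eq_zero_of_notMem_fieldSupport hx

theorem abs_le_one_of_mem_testFields {Ω : Set (E n)} {g : Fin (n + 1) → E n → ℝ}
    (hg : g ∈ testFields Ω) (i : Fin (n + 1)) (x : E n) : |g i x| ≤ 1 := by
  rw [← sq_le_one_iff_abs_le_one]
  exact (Finset.single_le_sum (f := fun j => g j x ^ 2) (fun j _ => sq_nonneg _)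
    (Finset.mem_univ i)).trans (hg.2 x)

theorem integrable_mul_fieldDiv {Ω : Set (E n)} {g : Fin (n + 1) → E n → ℝ}
    (hg : g ∈ testFields Ω) {μ : Measure (E n)} {v : E n → ℝ} (hv : Integrable v μ) :
    Integrable (fun x => v x * fieldDiv g x) μ := by
  obtain ⟨C, hC⟩ := (continuous_fieldDiv hg).bounded_above_of_compact_support
    (hasCompactSupport_fieldDiv hg)
  exact hv.mul_bdd (c := C) (continuous_fieldDiv hg).aestronglyMeasurable (Eventually.of_forall hC)

theorem translate_mem_testFields {Ω : Set (E n)} {g : Fin (n + 1) → E n → ℝ}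
    (hg : g ∈ testFields Ω) {t : E n} (ht : ∀ x, x + t ∈ fieldSupport g → x ∈ Ω) :
    (fun i x => g i (x + t)) ∈ testFields Ω := by
  refine ⟨fun i => ⟨?_, ?_, ?_⟩, fun x => hg.2 _⟩
  · exact (hg.1 i).1.comp (contDiff_id.add contDiff_const)
  · exact (hg.1 i).2.1.comp_homeomorph (Homeomorph.addRight t)
  · intro x hx
    have h := tsupport_comp_eq_preimage (g i) (Homeomorph.addRight t)
    have hx' : x ∈ tsupport (g i ∘ Homeomorph.addRight t) := hx
    rw [h] at hx'
    exact ht x (mem_iUnion.2 ⟨i, hx'⟩)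

theorem fieldDiv_translate (g : Fin (n + 1) → E n → ℝ) (t x : E n) :
    fieldDiv (fun i x => g i (x + t)) x = fieldDiv g (x + t) := by
  simp only [fieldDiv, divn, fderiv_comp_add_right]

/-! ### Mollification. -/

/-- The mollification of `v` by a smooth bump function. -/
noncomputable def mollify (φ : ContDiffBump (0 : E n)) (v : E n → ℝ) : E n → ℝ :=
  convolution (φ.normed volume) v (ContinuousLinearMap.lsmul ℝ ℝ) volume

theorem contDiff_mollify (φ : ContDiffBump (0 : E n)) {v : E n → ℝ} (hv : Integrable v) :
    ContDiff ℝ 1 (mollify φ v) :=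
  φ.hasCompactSupport_normed.contDiff_convolution_left (n := 1) _ φ.contDiff_normed
    hv.locallyIntegrable

theorem mollify_apply (φ : ContDiffBump (0 : E n)) (v : E n → ℝ) (x : E n) :
    mollify φ v x = ∫ t, φ.normed volume t * v (x - t) := rfl

theorem mollify_nonneg (φ : ContDiffBump (0 : E n)) {v : E n → ℝ} (hv : 0 ≤ᵐ[volume] v)
    (x : E n) : 0 ≤ mollify φ v x := by
  rw [mollify_apply]
  refine integral_nonneg_of_ae ?_
  have h := (quasiMeasurePreserving_sub_left_of_right_invariant volume x).ae hv
  filter_upwards [h] with t ht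
  exact mul_nonneg (φ.nonneg_normed t) ht

theorem integrable_mollify (φ : ContDiffBump (0 : E n)) {v : E n → ℝ} (hv : Integrable v) :
    Integrable (mollify φ v) :=
  φ.integrable_normed.integrable_convolution _ hv

/-- By Fubini the left side is an average, with weights `φ.normed`, of the integrals of `v` against
translates of `H`, so a bound for all small translates is inherited. -/
theorem integral_mollify_mul_le (φ : ContDiffBump (0 : E n)) {v : E n → ℝ} (hv : Integrable v)
    {H : E n → ℝ} (hH : Continuous H) (hHc : HasCompactSupport H) {M : ℝ}
    (hM : ∀ t, ‖t‖ < φ.rOut → ∫ x, v x * H (x + t) ≤ M) :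
    ∫ x, mollify φ v x * H x ≤ M := by
  obtain ⟨C, hC⟩ := hH.bounded_above_of_compact_support hHc
  have hφ : Integrable (φ.normed (volume : Measure (E n))) := φ.integrable_normed
  have hint : Integrable (fun p : E n × E n => φ.normed volume p.2 * v (p.1 - p.2) * H p.1)
      (volume.prod volume) :=
    (hφ.convolution_integrand (ContinuousLinearMap.lsmul ℝ ℝ) hv).mul_bdd (c := C)
      (hH.comp continuous_fst).aestronglyMeasurable (Eventually.of_forall fun p => hC p.1)
  have h1 : ∫ x, mollify φ v x * H x =
      ∫ t, φ.normed volume t * ∫ x, v x * H (x + t) := by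
    calc ∫ x, mollify φ v x * H x
        = ∫ x, ∫ t, φ.normed volume t * v (x - t) * H x := by
          simp only [mollify_apply, integral_mul_const]
      _ = ∫ t, ∫ x, φ.normed volume t * v (x - t) * H x := integral_integral_swap hint
      _ = _ := by
          refine integral_congr_ae (Eventually.of_forall fun t => ?_)
          simp only [mul_assoc, integral_const_mul]
          congr 1
          rw [← integral_add_right_eq_self (fun x => v (x - t) * H x) t]
          simp
  have h2 : Integrable (fun t => φ.normed volume t * ∫ x, v x * H (x + t)) := by
    refine hφ.mul_bdd (c := ∫ x, ‖v x‖ * C) ?_ (Eventually.of_forall fun t => ?_)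
    · refine (continuous_of_dominated (bound := fun x => ‖v x‖ * C) ?_ ?_ ?_ ?_).aestronglyMeasurable
      · exact fun t => hv.aestronglyMeasurable.mul
          (hH.comp (continuous_id.add continuous_const)).aestronglyMeasurable
      · refine fun t => Eventually.of_forall fun x => ?_
        rw [norm_mul]
        exact mul_le_mul_of_nonneg_left (hC _) (norm_nonneg _)
      · exact hv.norm.mul_const C
      · exact Eventually.of_forall fun x => by fun_prop
    · refine norm_integral_le_of_norm_le (hv.norm.mul_const C) (Eventually.of_forall fun x => ?_)
      rw [norm_mul]
      exact mul_le_mul_of_nonneg_left (hC _) (norm_nonneg _)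
  rw [h1]
  calc ∫ t, φ.normed volume t * ∫ x, v x * H (x + t)
      ≤ ∫ t, φ.normed volume t * M := by
        refine integral_mono h2 (hφ.mul_const M) fun t => ?_
        by_cases ht : ‖t‖ < φ.rOut
        · exact mul_le_mul_of_nonneg_left (hM t ht) (φ.nonneg_normed t)
        · have : t ∉ Function.support (φ.normed (volume : Measure (E n))) := by
            rw [φ.support_normed_eq]; simpa using ht
          rw [Function.notMem_support] at this
          simp [this]
    _ = M := by rw [integral_mul_const, φ.integral_normed, one_mul]

/-- Testing the mollification of `v` with a field supported well inside `Ω` gives at most the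
surface energy of `v`. -/
theorem integral_mollify_mul_fieldDiv_le {Ω : Set (E n)} {v : E n → ℝ} (hv : Integrable v) {s : ℝ}
    (hs : ∀ g ∈ testFields Ω, ∫ x, v x * fieldDiv g x ≤ s) {g : Fin (n + 1) → E n → ℝ}
    (hg : g ∈ testFields Ω) (φ : ContDiffBump (0 : E n))
    (hφ : Metric.thickening φ.rOut (fieldSupport g) ⊆ Ω) :
    ∫ x, mollify φ v x * fieldDiv g x ≤ s := by
  refine integral_mollify_mul_le φ hv (continuous_fieldDiv hg) (hasCompactSupport_fieldDiv hg) ?_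
  intro t ht
  have h := hs _ (translate_mem_testFields hg (t := t) fun x hx => hφ ?_)
  · simpa only [fieldDiv_translate] using h
  · exact Metric.mem_thickening_iff.2 ⟨_, hx, by simpa [dist_eq_norm] using ht⟩

/-! ### The surface comparison for smooth functions. -/

theorem integral_fderiv_apply_eq_zero {f : E n → ℝ} (hf : ContDiff ℝ 1 f)
    (hc : HasCompactSupport f) (e : E n) : ∫ x, fderiv ℝ f x e = 0 := by
  have hi : Integrable (fun x => fderiv ℝ f x e) :=
    ((hf.continuous_fderiv one_ne_zero).clm_apply continuous_const).integrable_of_hasCompactSupport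
      (hc.fderiv_apply ℝ e)
  have h := integral_mul_fderiv_eq_neg_fderiv_mul_of_integrable (μ := volume)
    (f := fun _ : E n => (1 : ℝ)) (g := f) (v := e) (by simp) (by simpa using hi)
    (by simpa using hf.continuous.integrable_of_hasCompactSupport hc)
    (fun x _ => differentiableAt_const _) (fun x _ => (hf.differentiable one_ne_zero) x)
  simpa using h

/-- The derivative of `lift c`. -/
noncomputable def slope (c s : ℝ) : ℝ := 1 - (max (c - s) 0) ^ 2 / 2

/-- The intercept at `0` of the tangent to the graph of `lift c` at `s`. -/
noncomputable def intercept (c s : ℝ) : ℝ := bump c s + s * ((max (c - s) 0) ^ 2 / 2)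

theorem hasDerivAt_slope (c s : ℝ) : HasDerivAt (slope c) (max (c - s) 0) s := by
  have := ((hasDerivAt_sub_posPart_pow c 0 s).div_const 2).const_sub 1
  convert! this using 1
  simp only [Nat.cast_zero, zero_add, pow_one]
  ring

/-- Differentiating `L - s L'` gives `-s L''`. This relation turns the gradient terms of the
comparison into an exact divergence. -/
theorem hasDerivAt_intercept (c s : ℝ) :
    HasDerivAt (intercept c) (-(s * max (c - s) 0)) s := by
  have h1 := (hasDerivAt_sub_posPart_pow c 1 s).div_const 6
  have h2 := (hasDerivAt_id s).mul ((hasDerivAt_sub_posPart_pow c 0 s).div_const 2)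
  convert! h1.add h2 using 1
  simp
  ring

theorem contDiff_slope (c : ℝ) : ContDiff ℝ 1 (slope c) :=
  contDiff_const.sub ((contDiff_sub_posPart_pow c 0).div_const 2)

theorem contDiff_intercept (c : ℝ) : ContDiff ℝ 1 (intercept c) :=
  ((contDiff_sub_posPart_pow c 1).div_const 6).add
    (contDiff_id.mul ((contDiff_sub_posPart_pow c 0).div_const 2))

theorem intercept_nonneg {c s : ℝ} (hs : 0 ≤ s) : 0 ≤ intercept c s :=
  add_nonneg (bump_nonneg c s) (by positivity)

theorem slope_le_one (c s : ℝ) : slope c s ≤ 1 := by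
  unfold slope; nlinarith [sq_nonneg (max (c - s) 0)]

theorem slope_nonneg {c s : ℝ} (hc : c ≤ 1) (hs : 0 ≤ s) : 0 ≤ slope c s := by
  unfold slope
  have h1 : max (c - s) 0 ≤ 1 := max_le (by linarith) zero_le_one
  have h2 : (max (c - s) 0) ^ 2 ≤ 1 := pow_le_one₀ (le_max_right _ _) h1
  linarith

theorem divn_comp_mul {u : E n → ℝ} {b : ℝ → ℝ} {b' : ℝ} {x : E n}
    {g : Fin (n + 1) → E n → ℝ} (hb : HasDerivAt b b' (u x)) (hu : DifferentiableAt ℝ u x)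
    (hg : ∀ i, DifferentiableAt ℝ (g i) x) {k : Fin (n + 1) → E n → ℝ}
    (hk : ∀ i : Fin n, k i.castSucc = fun y => b (u y) * g i.castSucc y) :
    divn k x = b (u x) * divn g x +
      b' * ∑ i : Fin n, fderiv ℝ u x (EuclideanSpace.single i 1) * g i.castSucc x := by
  have hbu : HasFDerivAt (fun y => b (u y)) (b' • fderiv ℝ u x) x :=
    hb.comp_hasFDerivAt x hu.hasFDerivAt
  simp only [divn, Finset.mul_sum, ← Finset.sum_add_distrib]
  refine Finset.sum_congr rfl fun i _ => ?_
  have h := hbu.mul (hg i.castSucc).hasFDerivAt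
  rw [show ((fun y => b (u y)) * g i.castSucc) = k i.castSucc from (hk i).symm] at h
  rw [h.fderiv]
  simp
  ring

theorem integral_divn_eq_zero {g : Fin (n + 1) → E n → ℝ} (hg : ∀ i, ContDiff ℝ 1 (g i))
    (hc : ∀ i, HasCompactSupport (g i)) : ∫ x, divn g x = 0 := by
  unfold divn
  rw [integral_finsetSum]
  · exact Finset.sum_eq_zero fun i _ => integral_fderiv_apply_eq_zero (hg _) (hc _) _
  · exact fun i _ => (((hg _).continuous_fderiv one_ne_zero).clm_apply
      continuous_const).integrable_of_hasCompactSupport ((hc _).fderiv_apply ℝ _)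

/-- The test field `slope c u • g + (1 - slope c u) θ e_{n+1}`. -/
noncomputable def mixedField (c : ℝ) (u θ : E n → ℝ) (g : Fin (n + 1) → E n → ℝ) :
    Fin (n + 1) → E n → ℝ :=
  fun i x => slope c (u x) * g i x +
    if i = Fin.last n then (1 - slope c (u x)) * θ x else 0

/-- The unit ball is convex; the estimate is convexity of the square in each component. -/
theorem sum_sq_convex_le_one {ι : Type*} [Fintype ι] [DecidableEq ι] {g : ι → ℝ} {j : ι} {a τ : ℝ}
    (ha0 : 0 ≤ a) (ha1 : a ≤ 1) (hg : ∑ i, g i ^ 2 ≤ 1) (hτ0 : 0 ≤ τ) (hτ1 : τ ≤ 1) :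
    ∑ i, (a * g i + if i = j then (1 - a) * τ else 0) ^ 2 ≤ 1 := by
  have h : ∀ i, (a * g i + if i = j then (1 - a) * τ else 0) ^ 2 ≤
      a * g i ^ 2 + if i = j then (1 - a) * τ ^ 2 else 0 := by
    intro i
    split_ifs
    · nlinarith [mul_nonneg ha0 (mul_nonneg (sub_nonneg.2 ha1) (sq_nonneg (g i - τ)))]
    · nlinarith [mul_nonneg ha0 (mul_nonneg (sub_nonneg.2 ha1) (sq_nonneg (g i)))]
  refine (Finset.sum_le_sum fun i _ => h i).trans ?_
  rw [Finset.sum_add_distrib, ← Finset.mul_sum, Finset.sum_ite_eq' Finset.univ j]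
  simp only [Finset.mem_univ, if_true]
  have : τ ^ 2 ≤ 1 := pow_le_one₀ hτ0 hτ1
  nlinarith

theorem mixedField_mem_testFields {Ω : Set (E n)} {c : ℝ} (hc : c ≤ 1) {u θ : E n → ℝ}
    (hu : ContDiff ℝ 1 u) (hu0 : ∀ x, 0 ≤ u x) (hθ : ContDiff ℝ 1 θ) (hθc : HasCompactSupport θ)
    (hθΩ : tsupport θ ⊆ Ω) (hθ01 : ∀ x, θ x ∈ Icc (0 : ℝ) 1) {g : Fin (n + 1) → E n → ℝ}
    (hg : g ∈ testFields Ω) :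
    mixedField c u θ g ∈ testFields Ω ∧
      fieldSupport (mixedField c u θ g) ⊆ fieldSupport g ∪ tsupport θ := by
  have hsl : ContDiff ℝ 1 fun x => slope c (u x) := (contDiff_slope c).comp hu
  have hz : ∀ i x, x ∉ tsupport (g i) ∪ tsupport θ → mixedField c u θ g i x = 0 := by
    intro i x hx
    rw [mem_union, not_or] at hx
    simp [mixedField, image_eq_zero_of_notMem_tsupport hx.1,
      image_eq_zero_of_notMem_tsupport hx.2]
  have hts : ∀ i, tsupport (mixedField c u θ g i) ⊆ tsupport (g i) ∪ tsupport θ := fun i =>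
    closure_minimal (fun x hx => by_contra fun h => hx (hz i x h))
      ((isClosed_tsupport _).union (isClosed_tsupport _))
  refine ⟨⟨fun i => ⟨?_, ?_, ?_⟩, fun x => ?_⟩, ?_⟩
  · unfold mixedField
    refine (hsl.mul (hg.1 i).1).add ?_
    split_ifs
    · exact (contDiff_const.sub hsl).mul hθ
    · exact contDiff_const
  · exact HasCompactSupport.intro' ((hg.1 i).2.1.isCompact.union hθc.isCompact)
      ((isClosed_tsupport _).union (isClosed_tsupport _)) (hz i)
  · exact (hts i).trans (union_subset (hg.1 i).2.2 hθΩ)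
  · exact sum_sq_convex_le_one (slope_nonneg hc (hu0 x)) (slope_le_one _ _) (hg.2 x)
      (hθ01 x).1 (hθ01 x).2
  · exact iUnion_subset fun i => (hts i).trans
      (union_subset_union_left _ (subset_iUnion (fun i => tsupport (g i)) i))

/-- The comparison inequality for a smooth function. -/
theorem integral_lift_mul_fieldDiv_le_of_contDiff {Ω : Set (E n)} {c : ℝ} (hc : c ≤ 1)
    {u θ : E n → ℝ} (hu : ContDiff ℝ 1 u) (hu0 : ∀ x, 0 ≤ u x) (hθ : ContDiff ℝ 1 θ)
    (hθc : HasCompactSupport θ) (hθΩ : tsupport θ ⊆ Ω) (hθ01 : ∀ x, θ x ∈ Icc (0 : ℝ) 1)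
    {g : Fin (n + 1) → E n → ℝ} (hg : g ∈ testFields Ω) (hθg : ∀ x ∈ fieldSupport g, θ x = 1)
    {s : ℝ} (hs : ∫ x, u x * fieldDiv (mixedField c u θ g) x ≤ s) :
    ∫ x, lift c (u x) * fieldDiv g x ≤ s + ∫ x, bump c (u x) * θ x := by
  have hh := (mixedField_mem_testFields hc hu hu0 hθ hθc hθΩ hθ01 hg).1
  have hud := fun x => hu.differentiable one_ne_zero x
  have hgd := fun x i => (hg.1 i).1.differentiable one_ne_zero x
  -- With `L = lift c`, one has `L(u) div g - u div (L'(u) g) = div ((L - u L') g)`, and this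
  -- compactly supported divergence integrates to zero.
  set k : Fin (n + 1) → E n → ℝ := fun i x => intercept c (u x) * g i x with hk
  have hkC : ∀ i, ContDiff ℝ 1 (k i) := fun i =>
    ((contDiff_intercept c).comp hu).mul (hg.1 i).1
  have hkc : ∀ i, HasCompactSupport (k i) := fun i => (hg.1 i).2.1.mul_left
  have hdk : Integrable (divn k) := by
    refine (continuous_divn hkC).integrable_of_hasCompactSupport
      (HasCompactSupport.intro (isCompact_iUnion fun i => (hkc i).isCompact) fun x hx => ?_)
    exact divn_eq_zero_of_notMem_fieldSupport hx
  have hk0 : ∫ x, divn k x = 0 := integral_divn_eq_zero hkC hkc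
  have hcl : Continuous (lift c) := continuous_id.add (continuous_bump c)
  have i1 : Integrable fun x => lift c (u x) * fieldDiv g x :=
    ((hcl.comp hu.continuous).mul (continuous_fieldDiv hg)).integrable_of_hasCompactSupport
      (hasCompactSupport_fieldDiv hg).mul_left
  have i2 : Integrable fun x => u x * fieldDiv (mixedField c u θ g) x :=
    (hu.continuous.mul (continuous_fieldDiv hh)).integrable_of_hasCompactSupport
      (hasCompactSupport_fieldDiv hh).mul_left
  have i3 : Integrable fun x => bump c (u x) * θ x :=
    (((continuous_bump c).comp hu.continuous).mul hθ.continuous).integrable_of_hasCompactSupport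
      hθc.mul_left
  have key : ∀ x, lift c (u x) * fieldDiv g x ≤
      u x * fieldDiv (mixedField c u θ g) x + divn k x + bump c (u x) * θ x := by
    intro x
    rw [divn_comp_mul (hasDerivAt_intercept c (u x)) (hud x) (hgd x) (k := k) fun i => rfl,
      fieldDiv, fieldDiv, divn_comp_mul (hasDerivAt_slope c (u x)) (hud x) (hgd x)
        (k := mixedField c u θ g) fun i => ?_]
    · simp only [mixedField, if_true]
      set q := max (c - u x) 0
      set d := ∑ i : Fin n, fderiv ℝ u x (EuclideanSpace.single i 1) * g i.castSucc x
      have hF := intercept_nonneg (c := c) (hu0 x)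
      have hsl : slope c (u x) = 1 - q ^ 2 / 2 := rfl
      have hin : intercept c (u x) = bump c (u x) + u x * (q ^ 2 / 2) := rfl
      -- Only the last component remains, with the nonnegative coefficient `L - u L'`; the cutoff
      -- `θ` is a compactly supported substitute for the constant 1.
      have hgθ : g (Fin.last n) x ≤ θ x := by
        by_cases hx : x ∈ fieldSupport g
        · rw [hθg x hx]; exact (abs_le.1 (abs_le_one_of_mem_testFields hg _ x)).2
        · rw [eq_zero_of_notMem_fieldSupport hx]; exact (hθ01 x).1
      have h1 := mul_le_mul_of_nonneg_left hgθ hF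
      rw [hin] at h1
      rw [hsl, hin, lift]
      linarith
    · funext y
      simp [mixedField, (Fin.castSucc_lt_last i).ne]
  calc ∫ x, lift c (u x) * fieldDiv g x
      ≤ ∫ x, (u x * fieldDiv (mixedField c u θ g) x + divn k x + bump c (u x) * θ x) :=
        integral_mono i1 ((i2.add hdk).add i3) key
    _ = (∫ x, u x * fieldDiv (mixedField c u θ g) x) + ∫ x, bump c (u x) * θ x := by
        have h1 := integral_add (i2.add hdk) i3
        have h2 := integral_add i2 hdk
        simp only [Pi.add_apply] at h1 h2
        rw [h1, h2, hk0, add_zero]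
    _ ≤ _ := by linarith

/-! ### The surface comparison for integrable functions. -/

theorem exists_cutoff {K Ω : Set (E n)} (hK : IsCompact K) (hΩ : IsOpen Ω) (hKΩ : K ⊆ Ω) :
    ∃ θ : E n → ℝ, ContDiff ℝ 1 θ ∧ HasCompactSupport θ ∧ tsupport θ ⊆ Ω ∧
      (∀ x, θ x ∈ Icc (0 : ℝ) 1) ∧ ∀ x ∈ K, θ x = 1 := by
  obtain ⟨L, hL, hKL, hLΩ⟩ := exists_compact_between hK hΩ hKΩ
  obtain ⟨θ, h1, h2, h3, h4⟩ := exists_contMDiff_support_eq_eq_one_iff (n := 1)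
    (modelWithCornersSelf ℝ (E n)) (isOpen_interior (s := L)) hK.isClosed hKL
  have hts : tsupport θ ⊆ L := by
    refine closure_minimal ?_ hL.isClosed
    rw [h3]; exact interior_subset
  exact ⟨θ, h1.contDiff, hL.of_isClosed_subset (isClosed_tsupport _) hts, hts.trans hLΩ,
    fun x => h2 (mem_range_self x), fun x hx => (h4 x).1 hx⟩

/-- Replacing `v` by `lift c v` raises the surface energy by at most `∫_Ω (lift c v - v)`. -/
theorem integral_lift_mul_fieldDiv_le {Ω : Set (E n)} (hΩ : IsOpen Ω) (hΩf : volume Ω ≠ ⊤)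
    {v : E n → ℝ} (hv : Integrable v)
    (hv0 : 0 ≤ᵐ[volume] v) {c : ℝ} (hc : c ≤ 1) {s : ℝ}
    (hs : ∀ g ∈ testFields Ω, ∫ x, v x * fieldDiv g x ≤ s) {g : Fin (n + 1) → E n → ℝ}
    (hg : g ∈ testFields Ω) :
    ∫ x, lift c (v x) * fieldDiv g x ≤ s + ∫ x in Ω, bump c (v x) := by
  obtain ⟨θ, hθ, hθc, hθΩ, hθ01, hθg⟩ :=
    exists_cutoff (isCompact_fieldSupport hg) hΩ (fieldSupport_subset hg)
  have hK : IsCompact (fieldSupport g ∪ tsupport θ) := (isCompact_fieldSupport hg).union hθc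
  obtain ⟨δ, hδ, hδΩ⟩ := hK.exists_thickening_subset_open hΩ
    (union_subset (fieldSupport_subset hg) hθΩ)
  -- The outer radius is twice the inner one: a bounded ratio gives almost everywhere convergence of
  -- the mollifications.
  let φ : ℕ → ContDiffBump (0 : E n) := fun k =>
    ⟨1 / (2 * (k + 1)), 1 / ((k : ℝ) + 1), by positivity, by
      apply one_div_lt_one_div_of_lt <;> [positivity; linarith [k.cast_nonneg (α := ℝ)]]⟩
  have hφ : Tendsto (fun k => (φ k).rOut) atTop (𝓝 0) := tendsto_one_div_add_atTop_nhds_zero_nat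
  have hφ2 : ∀ k, (φ k).rOut ≤ 2 * (φ k).rIn := fun k => by
    have : (0 : ℝ) < k + 1 := by positivity
    change 1 / ((k : ℝ) + 1) ≤ 2 * (1 / (2 * (k + 1)))
    apply le_of_eq; field_simp
  have hae : ∀ᵐ x, Tendsto (fun k => mollify (φ k) v x) atTop (𝓝 (v x)) :=
    ContDiffBump.ae_convolution_tendsto_right_of_locallyIntegrable hφ
      (Eventually.of_forall hφ2) hv.locallyIntegrable
  have hH := continuous_fieldDiv hg
  have hHc := hasCompactSupport_fieldDiv hg
  have hHi : Integrable (fieldDiv g) := hH.integrable_of_hasCompactSupport hHc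
  -- the part of the limit that is linear in `v`
  have lower : ∀ τ > 0, ∀ᶠ k in atTop,
      (∫ x, v x * fieldDiv g x) - τ ≤ ∫ x, mollify (φ k) v x * fieldDiv g x := by
    intro τ hτ
    set A := ∫ x, ‖v x‖
    have hA : 0 ≤ A := integral_nonneg fun x => norm_nonneg _
    -- Small translations change `fieldDiv g` uniformly little, at a cost of at most `A * τ / (A +
    -- 1) ≤ τ`; the `+ 1` covers `A = 0`. The lower bound follows by applying the mollification
    -- bound to `-fieldDiv g`.
    obtain ⟨ρ, hρ, hρH⟩ := Metric.uniformContinuous_iff.1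
      (hHc.uniformContinuous_of_continuous hH) (τ / (A + 1)) (by positivity)
    filter_upwards [hφ.eventually (gt_mem_nhds hρ)] with k hk
    have h := integral_mollify_mul_le (φ k) hv (H := fun x => -fieldDiv g x) hH.neg hHc.neg
      (M := -(∫ x, v x * fieldDiv g x) + τ) fun t ht => ?_
    · simp only [mul_neg, integral_neg] at h
      linarith
    · have j1 := integrable_mul_fieldDiv hg hv
      have j2 : Integrable fun x => v x * fieldDiv g (x + t) := by
        obtain ⟨C, hC⟩ := hH.bounded_above_of_compact_support hHc
        exact hv.mul_bdd (c := C) (hH.comp (continuous_id.add continuous_const)).aestronglyMeasurable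
          (Eventually.of_forall fun x => hC _)
      have j3 : (∫ x, v x * fieldDiv g x) - (∫ x, v x * fieldDiv g (x + t)) ≤
          ∫ x, ‖v x‖ * (τ / (A + 1)) := by
        rw [← integral_sub j1 j2]
        refine integral_mono (j1.sub j2) (hv.norm.mul_const _) fun x => ?_
        rw [← mul_sub]
        refine (le_abs_self _).trans ?_
        rw [abs_mul]
        refine mul_le_mul_of_nonneg_left ?_ (abs_nonneg _)
        have := hρH (a := x) (b := x + t) (by simpa [dist_eq_norm] using ht.trans hk)
        exact this.le
      rw [integral_mul_const] at j3
      have j4 : A * (τ / (A + 1)) ≤ τ := by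
        rw [mul_div_assoc', div_le_iff₀ (by positivity)]
        nlinarith
      simp only [mul_neg, integral_neg]
      linarith
  have hcb := continuous_bump c
  -- The nonlinear part is bounded by 1 on nonnegative values, so dominated convergence applies with
  -- majorant `‖G‖`.
  have tend : ∀ {G : E n → ℝ}, Integrable G →
      Tendsto (fun k => ∫ x, bump c (mollify (φ k) v x) * G x) atTop
        (𝓝 (∫ x, bump c (v x) * G x)) := by
    intro G hG
    refine tendsto_integral_of_dominated_convergence (fun x => ‖G x‖) (fun k => ?_) hG.norm
      (fun k => Eventually.of_forall fun x => ?_) ?_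
    · exact (hcb.comp (contDiff_mollify (φ k) hv).continuous).aestronglyMeasurable.mul
        hG.aestronglyMeasurable
    · rw [norm_mul]
      exact mul_le_of_le_one_left (norm_nonneg _) (abs_bump_le_one hc (mollify_nonneg _ hv0 x))
    · filter_upwards [hae] with x hx
      exact ((hcb.tendsto _).comp hx).mul_const _
  have hθi : Integrable θ := hθ.continuous.integrable_of_hasCompactSupport hθc
  have hbv : ∀ {G : E n → ℝ}, Integrable G → Integrable fun x => bump c (v x) * G x := by
    intro G hG
    refine hG.bdd_mul (c := 1) (hcb.comp_aestronglyMeasurable hv.aestronglyMeasurable) ?_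
    filter_upwards [hv0] with x hx
    exact abs_bump_le_one hc hx
  have step : ∀ τ > 0, ∀ᶠ k in atTop, (∫ x, v x * fieldDiv g x) - τ +
      ∫ x, bump c (mollify (φ k) v x) * fieldDiv g x ≤
        s + ∫ x, bump c (mollify (φ k) v x) * θ x := by
    intro τ hτ
    filter_upwards [lower τ hτ, hφ.eventually (gt_mem_nhds hδ)] with k hk1 hk2
    have hu := contDiff_mollify (φ k) hv
    have hu0 := mollify_nonneg (φ k) hv0
    have hm := mixedField_mem_testFields hc hu hu0 hθ hθc hθΩ hθ01 hg
    have h := integral_lift_mul_fieldDiv_le_of_contDiff hc hu hu0 hθ hθc hθΩ hθ01 hg hθg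
      (integral_mollify_mul_fieldDiv_le hv hs hm.1 (φ k)
        ((Metric.thickening_mono hk2.le _).trans
          ((Metric.thickening_subset_of_subset δ hm.2).trans hδΩ)))
    have i1 : Integrable fun x => mollify (φ k) v x * fieldDiv g x :=
      integrable_mul_fieldDiv hg (integrable_mollify (φ k) hv)
    have i2 : Integrable fun x => bump c (mollify (φ k) v x) * fieldDiv g x :=
      ((hcb.comp hu.continuous).mul hH).integrable_of_hasCompactSupport hHc.mul_left
    simp only [lift, add_mul] at h
    rw [integral_add i1 i2] at h
    linarith
  have lim : ∀ τ > 0, (∫ x, v x * fieldDiv g x) - τ + ∫ x, bump c (v x) * fieldDiv g x ≤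
      s + ∫ x, bump c (v x) * θ x := fun τ hτ =>
    le_of_tendsto_of_tendsto ((tend hHi).const_add _) ((tend hθi).const_add _) (step τ hτ)
  have last : ∫ x, bump c (v x) * θ x ≤ ∫ x in Ω, bump c (v x) := by
    have hz : ∀ x, x ∉ Ω → bump c (v x) * θ x = 0 := fun x hx => by
      rw [image_eq_zero_of_notMem_tsupport fun h => hx (hθΩ h), mul_zero]
    rw [← setIntegral_eq_integral_of_forall_compl_eq_zero hz]
    refine integral_mono (hbv hθi).integrableOn ?_ fun x =>
      mul_le_of_le_one_right (bump_nonneg _ _) (hθ01 x).2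
    refine Measure.integrableOn_of_bounded hΩf
      (hcb.comp_aestronglyMeasurable hv.aestronglyMeasurable) (M := 1) ?_
    filter_upwards [ae_restrict_of_ae hv0] with x hx
    exact abs_bump_le_one hc hx
  have fin : (∫ x, v x * fieldDiv g x) + ∫ x, bump c (v x) * fieldDiv g x ≤
      s + ∫ x, bump c (v x) * θ x :=
    le_of_forall_pos_le_add fun τ hτ => by linarith [lim τ hτ]
  simp only [lift, add_mul]
  rw [integral_add (integrable_mul_fieldDiv hg hv) (hbv hHi)]
  linarith

/-! ### Boundary traces. -/

/-- Near a boundary point, averaging over `B_r(x) ∩ Ω` is integration against a probability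
measure. -/
theorem exists_isProbabilityMeasure_setAverage {Ω : Set (E n)} (hΩ : IsOpen Ω) {x : E n}
    (hx : x ∈ frontier Ω) {r : ℝ} (hr : 0 < r) :
    ∃ κ : Measure (E n), IsProbabilityMeasure κ ∧ κ ≪ volume.restrict Ω ∧
      (∀ f : E n → ℝ, IntegrableOn f Ω → Integrable f κ) ∧
      ∀ f : E n → ℝ, (⨍ y in Metric.ball x r ∩ Ω, f y) = ∫ y, f y ∂κ := by
  have hne : (Metric.ball x r ∩ Ω).Nonempty :=
    mem_closure_iff.1 (frontier_subset_closure hx) _ Metric.isOpen_ball (Metric.mem_ball_self hr)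
  have hpos : volume (Metric.ball x r ∩ Ω) ≠ 0 :=
    ((Metric.isOpen_ball.inter hΩ).measure_pos _ hne).ne'
  have hfin : volume (Metric.ball x r ∩ Ω) ≠ ⊤ :=
    ((measure_mono inter_subset_left).trans_lt measure_ball_lt_top).ne
  set μ := (volume : Measure (E n)).restrict (Metric.ball x r ∩ Ω) with hμ
  have hu : μ univ = volume (Metric.ball x r ∩ Ω) := by simp [hμ]
  have hle : μ ≤ volume.restrict Ω := Measure.restrict_mono inter_subset_right le_rfl
  refine ⟨(μ univ)⁻¹ • μ, ⟨?_⟩, ?_, fun f hf => ?_, fun f => rfl⟩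
  · rw [Measure.smul_apply, smul_eq_mul, hu]
    exact ENNReal.inv_mul_cancel hpos hfin
  · exact (Measure.smul_absolutelyContinuous).trans hle.absolutelyContinuous
  · refine Integrable.smul_measure (Integrable.mono_measure hf hle) ?_
    rw [hu]; exact ENNReal.inv_ne_top.2 hpos

section trace

variable {Ω : Set (E n)} (hΩ : IsOpen Ω) {v : E n → ℝ} (hv : IntegrableOn v Ω) {x : E n}
  (hx : x ∈ frontier Ω)

include hΩ hv hx

theorem abs_sub_le_setAverage {r : ℝ} (hr : 0 < r) (a b : ℝ) :
    |a - b| ≤ (⨍ y in Metric.ball x r ∩ Ω, |v y - a|) + ⨍ y in Metric.ball x r ∩ Ω, |v y - b| := by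
  obtain ⟨κ, hκ, -, hi, he⟩ := exists_isProbabilityMeasure_setAverage hΩ hx hr
  have hj : ∀ a : ℝ, Integrable (fun y => |v y - a|) κ := fun a =>
    ((hi v hv).sub (integrable_const a)).abs
  rw [he, he, ← integral_add (hj a) (hj b)]
  have h : ∫ _, |a - b| ∂κ ≤ ∫ y, (|v y - a| + |v y - b|) ∂κ :=
    integral_mono (integrable_const _) ((hj a).add (hj b)) fun y => by
      have := abs_sub_le a (v y) b
      rwa [abs_sub_comm a (v y)] at this
  simpa using h

theorem setAverage_abs_sub_le {r : ℝ} (hr : 0 < r) (a b : ℝ) :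
    (⨍ y in Metric.ball x r ∩ Ω, |v y - a|) ≤
      (⨍ y in Metric.ball x r ∩ Ω, |v y - b|) + |a - b| := by
  obtain ⟨κ, hκ, -, hi, he⟩ := exists_isProbabilityMeasure_setAverage hΩ hx hr
  have hj : ∀ a : ℝ, Integrable (fun y => |v y - a|) κ := fun a =>
    ((hi v hv).sub (integrable_const a)).abs
  rw [he, he]
  have h : ∫ y, |v y - a| ∂κ ≤ ∫ y, (|v y - b| + |a - b|) ∂κ :=
    integral_mono (hj a) ((hj b).add (integrable_const _)) fun y => by
      have := abs_sub_le (v y) b a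
      rwa [abs_sub_comm b a] at this
  rw [integral_add (hj b) (integrable_const _)] at h
  simpa using h

theorem abs_setAverage_sub_le {r : ℝ} (hr : 0 < r) (a : ℝ) :
    |(⨍ y in Metric.ball x r ∩ Ω, v y) - a| ≤ ⨍ y in Metric.ball x r ∩ Ω, |v y - a| := by
  obtain ⟨κ, hκ, -, hi, he⟩ := exists_isProbabilityMeasure_setAverage hΩ hx hr
  rw [he, he]
  have h : ∫ y, (v y - a) ∂κ = (∫ y, v y ∂κ) - a := by
    rw [integral_sub (hi v hv) (integrable_const _)]; simp
  rw [← h]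
  exact abs_integral_le_integral_abs

theorem le_of_isTraceAt {a c : ℝ} (ha : ∀ᵐ y ∂(volume.restrict Ω), a ≤ v y)
    (hc : IsTraceAt Ω v x c) : a ≤ c := by
  have : a - c ≤ 0 := by
    refine ge_of_tendsto hc ?_
    filter_upwards [self_mem_nhdsWithin] with r hr
    obtain ⟨κ, hκ, hac, hi, he⟩ := exists_isProbabilityMeasure_setAverage hΩ hx hr
    rw [he]
    have h : ∫ _, (a - c) ∂κ ≤ ∫ y, |v y - c| ∂κ := by
      refine integral_mono_ae (integrable_const _) ((hi v hv).sub (integrable_const c)).abs ?_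
      filter_upwards [hac.ae_le ha] with y hy
      exact (sub_le_sub_right hy c).trans (le_abs_self _)
    simpa using h
  linarith

theorem trace_eq {c : ℝ} (hc : IsTraceAt Ω v x c) : trace Ω v x = c := by
  have h : ∃ c, IsTraceAt Ω v x c := ⟨c, hc⟩
  rw [trace, dif_pos h]
  exact h.choose_spec.unique hΩ hv hx hc

theorem isTraceAt_of_le {w : E n → ℝ} {c d C : ℝ} (hw : IntegrableOn w Ω)
    (h : ∀ᵐ y ∂(volume.restrict Ω), |w y - d| ≤ C * |v y - c|) (hc : IsTraceAt Ω v x c) :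
    IsTraceAt Ω w x d := by
  have hc' := hc.const_mul C
  rw [mul_zero] at hc'
  refine squeeze_zero' ?_ ?_ hc'
  · filter_upwards [self_mem_nhdsWithin] with r hr
    obtain ⟨κ, hκ, -, -, he⟩ := exists_isProbabilityMeasure_setAverage hΩ hx hr
    rw [he]
    exact integral_nonneg fun y => abs_nonneg _
  · filter_upwards [self_mem_nhdsWithin] with r hr
    obtain ⟨κ, hκ, hac, hi, he⟩ := exists_isProbabilityMeasure_setAverage hΩ hx hr
    rw [he, he, ← integral_const_mul]
    exact integral_mono_ae ((hi w hw).sub (integrable_const d)).abs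
      (((hi v hv).sub (integrable_const c)).abs.const_mul C) (hac.ae_le h)

/-- The traces of `v` and of `lift c v` exist at the same points and are related by `lift c`. -/
theorem trace_le_trace_lift {c : ℝ} (hc : c ≤ 1)
    (hv0 : ∀ᵐ y ∂(volume.restrict Ω), 0 ≤ v y) (hw : IntegrableOn (fun y => lift c (v y)) Ω) :
    trace Ω v x ≤ trace Ω (fun y => lift c (v y)) x ∧
      trace Ω (fun y => lift c (v y)) x ≤ trace Ω v x + 1 := by
  by_cases h : ∃ t, IsTraceAt Ω v x t
  · obtain ⟨t, ht⟩ := h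
    have ht0 : 0 ≤ t := le_of_isTraceAt hΩ hv hx hv0 ht
    have ht' : IsTraceAt Ω (fun y => lift c (v y)) x (lift c t) := by
      refine isTraceAt_of_le hΩ hv hx (C := 1) hw ?_ ht
      filter_upwards [hv0] with y hy
      rw [one_mul]
      exact (lift_bilipschitz hc hy ht0).1
    rw [trace_eq hΩ hv hx ht, trace_eq hΩ hw hx ht', lift]
    exact ⟨by linarith [bump_nonneg c t], by linarith [bump_le_one hc ht0]⟩
  -- Where `v` has no trace, neither has `lift c v`, so both take the default value 0. A trace of
  -- `lift c v` would lie in the range of `lift c` on `[0, ∞)` and could be pulled back by the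
  -- inverse Lipschitz bound.
  · have h' : ¬ ∃ s, IsTraceAt Ω (fun y => lift c (v y)) x s := by
      rintro ⟨s, hs⟩
      have hs0 : lift c 0 ≤ s := by
        refine le_of_isTraceAt hΩ hw hx ?_ hs
        filter_upwards [hv0] with y hy
        have := bump_sub_le hc le_rfl hy
        unfold lift
        linarith
      have hs1 : 0 ≤ s := le_trans (by unfold lift; linarith [bump_nonneg c 0]) hs0
      have hcl : Continuous (lift c) := continuous_id.add (continuous_bump c)
      obtain ⟨t, ht, rfl⟩ := intermediate_value_Icc hs1 hcl.continuousOn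
        ⟨hs0, by unfold lift; linarith [bump_nonneg c s]⟩
      refine h ⟨t, isTraceAt_of_le hΩ hw hx (C := 2) hv ?_ hs⟩
      filter_upwards [hv0] with y hy
      exact (lift_bilipschitz hc hy ht.1).2
    rw [trace, trace, dif_neg h, dif_neg h']
    norm_num

/-- An open ball is the increasing union of concentric balls with rational radii tending to `r` from
below, so averages converge along such radii. -/
theorem setAverage_le_of_forall_rat {q δ τ : ℝ}
    (h : ∀ r : ℚ, (0 : ℝ) < r → (r : ℝ) < δ → ⨍ y in Metric.ball x r ∩ Ω, |v y - q| ≤ τ)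
    {r : ℝ} (hr : 0 < r) (hrδ : r ≤ δ) : ⨍ y in Metric.ball x r ∩ Ω, |v y - q| ≤ τ := by
  obtain ⟨u, hu, hur, hut⟩ := Real.exists_seq_rat_strictMono_tendsto r
  have hU : (⋃ k, Metric.ball x (u k) ∩ Ω) = Metric.ball x r ∩ Ω := by
    rw [← iUnion_inter]
    congr 1
    ext y
    simp only [mem_iUnion, Metric.mem_ball]
    constructor
    · rintro ⟨k, hk⟩
      exact hk.trans (hur k)
    · intro hy
      exact (hut.eventually (lt_mem_nhds hy)).exists
  have hm : Monotone fun k => Metric.ball x (u k) ∩ Ω := fun i j hij =>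
    inter_subset_inter_left _ (Metric.ball_subset_ball (by exact_mod_cast hu.monotone hij))
  have hfin : volume (Metric.ball x r ∩ Ω) ≠ ⊤ :=
    ((measure_mono inter_subset_left).trans_lt measure_ball_lt_top).ne
  have hne : (Metric.ball x r ∩ Ω).Nonempty :=
    mem_closure_iff.1 (frontier_subset_closure hx) _ Metric.isOpen_ball (Metric.mem_ball_self hr)
  have hpos : volume.real (Metric.ball x r ∩ Ω) ≠ 0 :=
    (ENNReal.toReal_pos ((Metric.isOpen_ball.inter hΩ).measure_pos _ hne).ne' hfin).ne'
  have key : ∀ f : E n → ℝ, IntegrableOn f (Metric.ball x r ∩ Ω) →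
      Tendsto (fun k => ∫ y in Metric.ball x (u k) ∩ Ω, f y) atTop
        (𝓝 (∫ y in Metric.ball x r ∩ Ω, f y)) := by
    intro f hf
    rw [← hU] at hf ⊢
    exact tendsto_setIntegral_of_monotone
      (fun k => (Metric.isOpen_ball.inter hΩ).measurableSet) hm hf
  have h1 := key (fun y => |v y - q|)
    (((hv.mono_set inter_subset_right).sub (integrableOn_const hfin)).abs)
  have h2 := key (fun _ => 1) (integrableOn_const hfin)
  simp only [setIntegral_const, smul_eq_mul, mul_one] at h2
  have h3 := (h2.inv₀ hpos).mul h1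
  rw [setAverage_eq, smul_eq_mul]
  refine le_of_tendsto h3 ?_
  filter_upwards [hut.eventually (lt_mem_nhds hr)] with k hk
  have := h (u k) hk ((hur k).trans_le hrδ)
  rwa [setAverage_eq, smul_eq_mul] at this

/-- A countable criterion for the existence of the trace. -/
theorem exists_isTraceAt_iff :
    (∃ c, IsTraceAt Ω v x c) ↔ ∀ m : ℕ, ∃ q : ℚ, ∃ k : ℕ, ∀ r : ℚ, (0 : ℝ) < r →
      (r : ℝ) < 1 / ((k : ℝ) + 1) → ⨍ y in Metric.ball x r ∩ Ω, |v y - q| ≤ 1 / ((m : ℝ) + 1) := by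
  constructor
  · rintro ⟨c, hc⟩ m
    have hm : (0 : ℝ) < 1 / ((m : ℝ) + 1) := by positivity
    obtain ⟨q, hq1, hq2⟩ := exists_rat_btwn (show c < c + 1 / ((m : ℝ) + 1) / 2 by linarith)
    have h1 := hc.eventually (gt_mem_nhds (half_pos hm))
    obtain ⟨δ, hδ, hδ'⟩ := mem_nhdsGT_iff_exists_Ioo_subset.1 h1
    obtain ⟨k, hk⟩ := exists_nat_one_div_lt (show (0 : ℝ) < δ from hδ)
    refine ⟨q, k, fun r hr hrk => ?_⟩
    have h2 := hδ' ⟨hr, hrk.trans hk⟩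
    have h3 := setAverage_abs_sub_le hΩ hv hx hr q c
    rw [abs_of_pos (sub_pos.2 hq1)] at h3
    simp only [mem_ofPred_eq] at h2
    linarith
  · intro h
    choose q k hqk using h
    -- Comparing two approximants on a common small ball shows that the `q m` form a Cauchy
    -- sequence; its limit is the trace.
    have hqk' : ∀ m, ∀ r : ℝ, 0 < r → r ≤ 1 / ((k m : ℝ) + 1) →
        ⨍ y in Metric.ball x r ∩ Ω, |v y - q m| ≤ 1 / ((m : ℝ) + 1) := fun m r hr hrk =>
      setAverage_le_of_forall_rat hΩ hv hx (hqk m) hr hrk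
    have hd : ∀ m l, |(q m : ℝ) - q l| ≤ 1 / ((m : ℝ) + 1) + 1 / ((l : ℝ) + 1) := by
      intro m l
      have hr : 0 < min (1 / ((k m : ℝ) + 1)) (1 / ((k l : ℝ) + 1)) := by positivity
      exact (abs_sub_le_setAverage hΩ hv hx hr _ _).trans
        (add_le_add (hqk' m _ hr (min_le_left _ _)) (hqk' l _ hr (min_le_right _ _)))
    have h0 : Tendsto (fun m : ℕ => 1 / ((m : ℝ) + 1)) atTop (𝓝 0) :=
      tendsto_one_div_add_atTop_nhds_zero_nat
    have hC : CauchySeq fun m => (q m : ℝ) := by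
      refine cauchySeq_of_le_tendsto_0' (fun m : ℕ => 1 / ((m : ℝ) + 1) + 1 / ((m : ℝ) + 1))
        (fun m l hml => (hd m l).trans ?_) (by simpa using h0.add h0)
      gcongr
    obtain ⟨c, hc⟩ := cauchySeq_tendsto_of_complete hC
    have hqc : ∀ m, |c - q m| ≤ 1 / ((m : ℝ) + 1) := by
      intro m
      have h1 := (hc.sub_const (q m : ℝ)).abs
      have h2 := h0.add_const (1 / ((m : ℝ) + 1))
      rw [zero_add] at h2
      exact le_of_tendsto_of_tendsto' h1 h2 fun l => hd l m
    refine ⟨c, ?_⟩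
    rw [IsTraceAt, Metric.tendsto_nhds]
    intro ε hε
    obtain ⟨m, hm⟩ := exists_nat_one_div_lt (half_pos hε)
    have hk : (0 : ℝ) < 1 / ((k m : ℝ) + 1) := by positivity
    filter_upwards [Ioo_mem_nhdsGT hk] with r hr
    have h1 := setAverage_abs_sub_le hΩ hv hx hr.1 c (q m)
    have h2 := hqk' m r hr.1 hr.2.le
    have h3 := abs_sub_le_setAverage hΩ hv hx hr.1 c c
    rw [sub_self, abs_zero] at h3
    rw [Real.dist_eq, sub_zero, abs_of_nonneg (by linarith)]
    linarith [hqc m]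

end trace

/-! ### Measurability of the trace, finiteness of surface measure, and the wetting energy. -/

theorem measurable_setIntegral_ball {Ω : Set (E n)} (hΩ : MeasurableSet Ω) {f : E n → ℝ}
    (hf : Measurable f) (r : ℝ) : Measurable fun x => ∫ y in Metric.ball x r ∩ Ω, f y := by
  have hS : MeasurableSet {p : E n × E n | dist p.2 p.1 < r ∧ p.2 ∈ Ω} :=
    (measurableSet_lt (measurable_snd.dist measurable_fst) measurable_const).inter
      (measurable_snd hΩ)
  have h := ((hf.comp measurable_snd).indicator hS).stronglyMeasurable.integral_prod_right'
    (ν := (volume : Measure (E n)))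
  convert! h.measurable using 2 with x
  rw [← integral_indicator (Metric.isOpen_ball.measurableSet.inter hΩ)]
  rfl

theorem measurable_setAverage_ball {Ω : Set (E n)} (hΩ : MeasurableSet Ω) {f : E n → ℝ}
    (hf : Measurable f) (r : ℝ) : Measurable fun x => ⨍ y in Metric.ball x r ∩ Ω, f y := by
  have h1 := measurable_setIntegral_ball hΩ (f := fun _ => 1) measurable_const r
  simp only [setIntegral_const, smul_eq_mul, mul_one] at h1
  simp only [setAverage_eq, smul_eq_mul]
  exact h1.inv.mul (measurable_setIntegral_ball hΩ hf r)

theorem measurable_setAverage_ball_comp {Ω : Set (E n)} (hΩ : MeasurableSet Ω) {v : E n → ℝ}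
    (hv : AEStronglyMeasurable v (volume.restrict Ω)) {b : ℝ → ℝ} (hb : Measurable b) (r : ℝ) :
    Measurable fun x => ⨍ y in Metric.ball x r ∩ Ω, b (v y) := by
  convert! measurable_setAverage_ball hΩ
    (hb.comp hv.stronglyMeasurable_mk.measurable) r using 2 with x
  have h : ∀ᵐ y ∂(volume.restrict (Metric.ball x r ∩ Ω)), v y = hv.mk v y :=
    ae_mono (Measure.restrict_mono inter_subset_right le_rfl) hv.ae_eq_mk
  refine average_congr ?_
  filter_upwards [h] with y hy
  simp [hy]

/-- On `∂Ω` the trace is the pointwise limit of averages over balls of radius `1 / (k + 1)`, cut off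
to the set `T` where the countable criterion holds; these are measurable in the centre. -/
theorem aemeasurable_trace {Ω : Set (E n)} (hΩ : IsOpen Ω) {v : E n → ℝ}
    (hv : IntegrableOn v Ω) : AEMeasurable (trace Ω v) (surfaceMeasure Ω) := by
  let T : Set (E n) := {x | ∀ m : ℕ, ∃ q : ℚ, ∃ k : ℕ, ∀ r : ℚ, (0 : ℝ) < r →
      (r : ℝ) < 1 / ((k : ℝ) + 1) → ⨍ y in Metric.ball x r ∩ Ω, |v y - q| ≤ 1 / ((m : ℝ) + 1)}
  have hT : MeasurableSet T := by
    refine measurableSet_setOfPred.2 <| Measurable.forall fun m => Measurable.exists fun q =>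
      Measurable.exists fun k => Measurable.forall fun r => Measurable.forall fun _ =>
      Measurable.forall fun _ => measurableSet_setOfPred.1 ?_
    exact measurableSet_le (measurable_setAverage_ball_comp hΩ.measurableSet
      hv.aestronglyMeasurable (b := fun s => |s - q|) (by fun_prop) r) measurable_const
  have hr0 : Tendsto (fun k : ℕ => 1 / ((k : ℝ) + 1)) atTop (𝓝[>] 0) :=
    tendsto_nhdsWithin_iff.2 ⟨tendsto_one_div_add_atTop_nhds_zero_nat,
      Eventually.of_forall fun k => by simp only [mem_Ioi]; positivity⟩
  refine aemeasurable_of_tendsto_metrizable_ae (u := atTop)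
    (f := fun (k : ℕ) => T.indicator fun x => ⨍ y in Metric.ball x (1 / ((k : ℝ) + 1)) ∩ Ω, v y)
    (fun k => ((measurable_setAverage_ball_comp hΩ.measurableSet
      hv.aestronglyMeasurable (b := id) measurable_id _).indicator hT).aemeasurable) ?_
  filter_upwards [ae_restrict_mem isClosed_frontier.measurableSet] with x hx
  by_cases hxT : x ∈ T
  · obtain ⟨c, hc⟩ := (exists_isTraceAt_iff hΩ hv hx).2 hxT
    simp only [indicator_of_mem hxT]
    rw [trace_eq hΩ hv hx hc, tendsto_iff_norm_sub_tendsto_zero]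
    exact squeeze_zero (fun k => norm_nonneg _)
      (fun k => abs_setAverage_sub_le hΩ hv hx (by positivity) c) (hc.comp hr0)
  · have h : ¬ ∃ c, IsTraceAt Ω v x c := fun h => hxT ((exists_isTraceAt_iff hΩ hv hx).1 h)
    simp only [indicator_of_notMem hxT]
    rw [trace, dif_neg h]
    exact tendsto_const_nhds

/-- Locally the boundary lies in the Lipschitz image, under the graph map `G`, of a bounded subset
of an `(n - 1)`-dimensional hyperplane; compactness of `∂Ω` does the rest. -/
theorem isFiniteMeasure_surfaceMeasure {Ω : Set (E n)} (hn : 1 ≤ n) (hΩo : IsOpen Ω)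
    (hΩb : Bornology.IsBounded Ω) (hΩL : HasLipschitzBoundary Ω) :
    IsFiniteMeasure (surfaceMeasure Ω) := by
  have hcomp : IsCompact (frontier Ω) :=
    Metric.isCompact_of_isClosed_isBounded isClosed_frontier
      (hΩb.closure.subset frontier_subset_closure)
  refine ⟨?_⟩
  rw [surfaceMeasure, Measure.restrict_apply_univ]
  refine hcomp.measure_lt_top_of_nhdsWithin fun p hp => ?_
  obtain ⟨r, hr, e, he, K, γ, hγ, h⟩ := hΩL p hp
  refine ⟨frontier Ω ∩ Metric.ball p r,
    inter_mem_nhdsWithin _ (Metric.ball_mem_nhds p hr), ?_⟩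
  let G : (ℝ ∙ e)ᗮ → E n := fun y => (y : E n) + γ y • e
  have hG : LipschitzWith (1 + K) G := by
    refine LipschitzWith.of_dist_le_mul fun y z => ?_
    have h1 : dist (γ y • e) (γ z • e) ≤ K * dist y z := by
      rw [dist_eq_norm, ← sub_smul, norm_smul, he, mul_one, ← dist_eq_norm]
      exact hγ.dist_le_mul y z
    calc dist (G y) (G z) ≤ dist (y : E n) z + dist (γ y • e) (γ z • e) := dist_add_add_le _ _ _ _
      _ ≤ dist y z + K * dist y z := by gcongr; exact le_rfl
      _ = _ := by push_cast; ring
  have hgraph : ∀ x ∈ frontier Ω ∩ Metric.ball p r,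
      inner ℝ e x = γ ((ℝ ∙ e)ᗮ.orthogonalProjectionOnto x) := by
    rintro x ⟨hx, hxb⟩
    refine le_antisymm ?_ ?_
    · have hx' : x ∈ closure (Metric.ball p r ∩ Ω) :=
        Metric.isOpen_ball.inter_closure ⟨hxb, frontier_subset_closure hx⟩
      have hcl : IsClosed {x : E n | inner ℝ e x ≤ γ ((ℝ ∙ e)ᗮ.orthogonalProjectionOnto x)} :=
        isClosed_le (by fun_prop) (hγ.continuous.comp (by fun_prop))
      exact closure_minimal (fun y hy => ((h y hy.1).1 hy.2).le) hcl hx'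
    · have hx' : x ∉ Ω := by
        rw [hΩo.frontier_eq] at hx
        exact hx.2
      exact not_lt.1 fun hlt => hx' ((h x hxb).2 hlt)
  have hsub : frontier Ω ∩ Metric.ball p r ⊆
      G '' ((ℝ ∙ e)ᗮ.orthogonalProjectionOnto '' Metric.ball p r) := by
    intro x hx
    refine ⟨_, mem_image_of_mem _ hx.2, ?_⟩
    change (((ℝ ∙ e)ᗮ.orthogonalProjectionOnto x : (ℝ ∙ e)ᗮ) : E n) + γ ((ℝ ∙ e)ᗮ.orthogonalProjectionOnto x) • e = x
    rw [← hgraph x hx]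
    have h1 := (ℝ ∙ e).starProjection_add_starProjection_orthogonal x
    rw [Submodule.starProjection_unit_singleton ℝ he] at h1
    rw [add_comm]
    exact h1
  have hfr : Module.finrank ℝ (ℝ ∙ e)ᗮ = n - 1 := by
    have : Fact (Module.finrank ℝ (E n) = (n - 1) + 1) := ⟨by simp; omega⟩
    exact Submodule.finrank_orthogonal_span_singleton (by
      intro h0; rw [h0, norm_zero] at he; exact zero_ne_one he)
  have hbd : Bornology.IsBounded ((ℝ ∙ e)ᗮ.orthogonalProjectionOnto '' Metric.ball p r) :=
    ((ℝ ∙ e)ᗮ.orthogonalProjectionOnto).lipschitz.isBounded_image Metric.isBounded_ball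
  have hfin : Measure.hausdorffMeasure (n - 1 : ℕ)
      ((ℝ ∙ e)ᗮ.orthogonalProjectionOnto '' Metric.ball p r) < ⊤ := by
    rw [← hfr]
    exact hbd.measure_lt_top
  refine (measure_mono hsub).trans_lt ?_
  rw [Measure.euclideanHausdorffMeasure_def, Measure.smul_apply]
  refine ENNReal.mul_lt_top ENNReal.coe_lt_top ?_
  refine (hG.hausdorffMeasure_image_le (Nat.cast_nonneg _) _).trans_lt ?_
  exact ENNReal.mul_lt_top (ENNReal.rpow_lt_top_of_nonneg (Nat.cast_nonneg _) ENNReal.coe_ne_top)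
    hfin

theorem wettingEnergy_lift_le {Ω : Set (E n)} (hn : 1 ≤ n) (hΩo : IsOpen Ω)
    (hΩb : Bornology.IsBounded Ω) (hΩL : HasLipschitzBoundary Ω) {β : E n → ℝ}
    (hβ : MemLp β ⊤ (surfaceMeasure Ω)) (hβ0 : ∀ᵐ x ∂(surfaceMeasure Ω), β x ≤ 0)
    {v : E n → ℝ} (hv : IntegrableOn v Ω) (hv0 : ∀ᵐ y ∂(volume.restrict Ω), 0 ≤ v y) {c : ℝ}
    (hc : c ≤ 1) (hw : IntegrableOn (fun y => lift c (v y)) Ω) :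
    wettingEnergy Ω β (fun y => lift c (v y)) ≤ wettingEnergy Ω β v := by
  have := isFiniteMeasure_surfaceMeasure hn hΩo hΩb hΩL
  set w : E n → ℝ := fun y => lift c (v y)
  set d : E n → ℝ := fun x => trace Ω w x - trace Ω v x
  have hd : ∀ᵐ x ∂(surfaceMeasure Ω), 0 ≤ d x ∧ d x ≤ 1 := by
    filter_upwards [ae_restrict_mem isClosed_frontier.measurableSet] with x hx
    have := trace_le_trace_lift hΩo hv hx hc hv0 hw
    constructor <;> simp only [d] <;> linarith
  have hβd : Integrable (fun x => β x * d x) (surfaceMeasure Ω) := by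
    refine (hβ.integrable le_top).mul_bdd (c := 1)
      ((aemeasurable_trace hΩo hw).sub (aemeasurable_trace hΩo hv)).aestronglyMeasurable ?_
    filter_upwards [hd] with x hx
    rw [Real.norm_eq_abs, abs_of_nonneg hx.1]
    exact hx.2
  have hvw : (fun x => β x * (1 - trace Ω v x)) =
      (fun x => β x * (1 - trace Ω w x)) + fun x => β x * d x := by
    funext x
    simp only [Pi.add_apply, d]
    ring
  unfold wettingEnergy
  rw [neg_le_neg_iff]
  by_cases hi : Integrable (fun x => β x * (1 - trace Ω w x)) (surfaceMeasure Ω)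
  · refine integral_mono_ae (by rw [hvw]; exact hi.add hβd) hi ?_
    filter_upwards [hd, hβ0] with x hx hβx
    have := mul_nonneg_of_nonpos_of_nonpos hβx (neg_nonpos.2 hx.1)
    simp only [d] at this
    linarith
  -- The two integrands differ by the integrable `β d`, so they fail to be integrable together, and
  -- both integrals then have the default value 0.
  · have hi' : ¬ Integrable (fun x => β x * (1 - trace Ω v x)) (surfaceMeasure Ω) := by
      rw [hvw]
      exact fun h => hi ((integrable_add_iff_integrable_left hβd).1 h)
    rw [integral_undef hi, integral_undef hi']

/-! ### Surface energy of the competitor and membership in `BV`. -/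

theorem zero_mem_testFields (Ω : Set (E n)) : (fun _ _ => 0) ∈ testFields Ω :=
  ⟨fun _ => ⟨contDiff_const, HasCompactSupport.zero, by simp [tsupport]⟩, fun _ => by simp⟩

theorem surfaceEnergy_nonneg (Ω : Set (E n)) (v : E n → ℝ) : 0 ≤ surfaceEnergy Ω v := by
  refine le_trans (le_of_eq ?_) (le_iSup₂ (fun _ _ => 0) (zero_mem_testFields Ω))
  simp [divn]

theorem surfaceEnergy_lift_le {Ω : Set (E n)} (hΩ : IsOpen Ω) (hΩf : volume Ω ≠ ⊤)
    {v : E n → ℝ} (hv : IntegrableOn v Ω) (hv0 : ∀ᵐ x ∂(volume.restrict Ω), 0 ≤ v x) {c : ℝ}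
    (hc : c ≤ 1) {s : ℝ} (hs : surfaceEnergy Ω v ≤ s) :
    surfaceEnergy Ω (fun x => lift c (v x)) ≤ ((s + ∫ x in Ω, bump c (v x) : ℝ) : EReal) := by
  have hm := hΩ.measurableSet
  -- Extension by zero permits convolution on the whole space; test fields vanish outside `Ω`, so no
  -- integral changes.
  set u := Ω.indicator v with hu
  have huΩ : ∀ x ∈ Ω, u x = v x := fun x hx => indicator_of_mem hx v
  have hui : Integrable u := hv.integrable_indicator hm
  have hu0 : 0 ≤ᵐ[volume] u := by
    filter_upwards [(ae_restrict_iff' hm).1 hv0] with x hx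
    exact indicator_apply_nonneg hx
  have heq : ∀ b : ℝ → ℝ, ∀ g ∈ testFields Ω,
      ∫ x, b (u x) * fieldDiv g x = ∫ x in Ω, b (v x) * (g (Fin.last n) x + divn g x) := by
    intro b g hg
    rw [← setIntegral_eq_integral_of_forall_compl_eq_zero (s := Ω)]
    · refine setIntegral_congr_fun hm fun x hx => ?_
      simp only [huΩ x hx, fieldDiv]
    · intro x hx
      rw [fieldDiv_eq_zero_of_notMem_fieldSupport fun h => hx (fieldSupport_subset hg h), mul_zero]
  have hb : ∫ x in Ω, bump c (u x) = ∫ x in Ω, bump c (v x) :=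
    setIntegral_congr_fun hm fun x hx => by simp only [huΩ x hx]
  refine iSup₂_le fun g hg => ?_
  rw [EReal.coe_le_coe_iff, ← heq (lift c) g hg, ← hb]
  refine integral_lift_mul_fieldDiv_le hΩ hΩf hui hu0 hc (fun k hk => ?_) hg
  have h := (iSup₂_le_iff.1 hs) k hk
  rw [EReal.coe_le_coe_iff] at h
  exact (heq id k hk).trans_le h

section comparison

variable {Ω : Set (E n)} (hΩf : volume Ω ≠ ⊤) {v : E n → ℝ} (hv : IntegrableOn v Ω)

include hΩf hv

/-- The two integrands differ by `(v - 1) g_{n+1}`, and `|g_{n+1}| ≤ 1`. Hence both functionals are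
finite for the same `v`, which allows `BV` membership to be read off from the surface energy. -/
theorem integral_surface_eq {g : Fin (n + 1) → E n → ℝ} (hg : g ∈ testFields Ω) :
    ∃ a : ℝ, |a| ≤ ∫ x in Ω, |v x - 1| ∧
      ∫ x in Ω, v x * (g (Fin.last n) x + divn g x) =
        (∫ x in Ω, (g (Fin.last n) x + v x * divn g x)) + a := by
  have h1 : IntegrableOn (fun x => v x - 1) Ω := hv.sub (integrableOn_const hΩf)
  have hgl : ∀ i, IntegrableOn (g i) Ω := fun i =>
    ((hg.1 i).1.continuous.integrable_of_hasCompactSupport (hg.1 i).2.1).integrableOn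
  have h2 : IntegrableOn (fun x => (v x - 1) * g (Fin.last n) x) Ω :=
    h1.mul_bdd (c := 1) (hg.1 _).1.continuous.aestronglyMeasurable
      (Eventually.of_forall fun x => abs_le_one_of_mem_testFields hg _ x)
  have h3 : IntegrableOn (fun x => v x * fieldDiv g x) Ω := integrable_mul_fieldDiv hg hv
  refine ⟨∫ x in Ω, (v x - 1) * g (Fin.last n) x, ?_, ?_⟩
  · refine norm_integral_le_of_norm_le (g := fun x => |v x - 1|) (f := fun x => (v x - 1) * g (Fin.last n) x)
      h1.abs (Eventually.of_forall fun x => ?_)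
    rw [norm_mul]
    exact mul_le_of_le_one_right (norm_nonneg _) (abs_le_one_of_mem_testFields hg _ x)
  · rw [← sub_eq_iff_eq_add]
    have h4 := integral_sub h3 h2
    simp only [fieldDiv] at h4
    rw [← h4]
    refine integral_congr_ae (Eventually.of_forall fun x => ?_)
    simp only
    ring

theorem surfaceEnergy_le_areaOne_add :
    surfaceEnergy Ω v ≤ areaOne Ω v + ((∫ x in Ω, |v x - 1| : ℝ) : EReal) := by
  refine iSup₂_le fun g hg => ?_
  obtain ⟨a, ha, h⟩ := integral_surface_eq hΩf hv hg
  rw [h, EReal.coe_add]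
  refine add_le_add ?_ (EReal.coe_le_coe_iff.2 ((le_abs_self a).trans ha))
  exact le_iSup₂ (f := fun (g : Fin (n + 1) → E n → ℝ) (_ : g ∈ testFields Ω) =>
    ((∫ x in Ω, (g (Fin.last n) x + v x * divn g x) : ℝ) : EReal)) g hg

theorem areaOne_le_surfaceEnergy_add :
    areaOne Ω v ≤ surfaceEnergy Ω v + ((∫ x in Ω, |v x - 1| : ℝ) : EReal) := by
  refine iSup₂_le fun g hg => ?_
  obtain ⟨a, ha, h⟩ := integral_surface_eq hΩf hv hg
  rw [← sub_eq_iff_eq_add] at h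
  rw [← h, sub_eq_add_neg, EReal.coe_add]
  refine add_le_add ?_ (EReal.coe_le_coe_iff.2 ((neg_le_abs a).trans ha))
  exact le_iSup₂ (f := fun (g : Fin (n + 1) → E n → ℝ) (_ : g ∈ testFields Ω) =>
    ((∫ x in Ω, v x * (g (Fin.last n) x + divn g x) : ℝ) : EReal)) g hg

theorem mem_BV_iff_surfaceEnergy_lt_top : v ∈ BV Ω ↔ surfaceEnergy Ω v < ⊤ := by
  constructor
  · rintro ⟨-, h⟩
    exact (surfaceEnergy_le_areaOne_add hΩf hv).trans_lt
      (EReal.add_lt_top h.ne (EReal.coe_ne_top _))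
  · intro h
    exact ⟨hv, (areaOne_le_surfaceEnergy_add hΩf hv).trans_lt
      (EReal.add_lt_top h.ne (EReal.coe_ne_top _))⟩

end comparison

/-! ### Strict decrease of the energy and conclusion. -/

theorem zero_mem_BVplus_and_J1_lt_top {Ω : Set (E n)} (hΩf : volume Ω ≠ ⊤) (β : E n → ℝ) :
    (fun _ => 0) ∈ BVplus Ω ∧ J1 Ω β (fun _ => 0) < ⊤ := by
  have hS : surfaceEnergy Ω (fun _ : E n => (0 : ℝ)) < ⊤ :=
    lt_of_le_of_lt (iSup₂_le fun g _ => by simp) EReal.zero_lt_top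
  have hP : potentialEnergy Ω (fun _ : E n => (0 : ℝ)) ≠ ⊤ := by
    simp [potentialEnergy, hΩf]
  refine ⟨⟨(mem_BV_iff_surfaceEnergy_lt_top hΩf integrableOn_zero).2 hS, by simp⟩, ?_⟩
  exact EReal.add_lt_top (EReal.add_ne_top hS.ne (by simpa using hP)) (EReal.coe_ne_top _)

theorem integrableOn_bump {Ω : Set (E n)} (hΩf : volume Ω ≠ ⊤) {v : E n → ℝ}
    (hv : IntegrableOn v Ω) (hv0 : ∀ᵐ x ∂(volume.restrict Ω), 0 ≤ v x) {c : ℝ} (hc : c ≤ 1) :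
    IntegrableOn (fun x => bump c (v x)) Ω := by
  have : IsFiniteMeasure (volume.restrict Ω) := isFiniteMeasure_restrict.2 hΩf
  refine Integrable.of_bound ((continuous_bump c).comp_aestronglyMeasurable
    hv.aestronglyMeasurable) 1 ?_
  filter_upwards [hv0] with x hx
  exact abs_bump_le_one hc hx

/-- Replacing `v` by `lift e⁻¹ v` lowers the potential energy by more than `∫_Ω (lift e⁻¹ v - v)`
unless `v ≥ e⁻¹`. -/
theorem potentialEnergy_lift_add_lt {Ω : Set (E n)} (hΩf : volume Ω ≠ ⊤) {v : E n → ℝ}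
    (hv : IntegrableOn v Ω) (hv0 : ∀ᵐ x ∂(volume.restrict Ω), 0 ≤ v x)
    (hP : potentialEnergy Ω v ≠ ⊤)
    (hlt : ¬ ∀ᵐ x ∂(volume.restrict Ω), Real.exp (-1) ≤ v x) :
    potentialEnergy Ω (fun x => lift (Real.exp (-1)) (v x)) +
      ENNReal.ofReal (∫ x in Ω, bump (Real.exp (-1)) (v x)) < potentialEnergy Ω v := by
  set c := Real.exp (-1) with hcdef
  have hc : c ≤ 1 := Real.exp_le_one_iff.2 (by norm_num)
  have hL : Measurable fun s : ℝ => ∫ h in (1 : ℝ)..s, Real.log h := by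
    simp only [integral_log_one]
    fun_prop
  have hvm := hv.aestronglyMeasurable.aemeasurable
  have hlift0 : ∀ s : ℝ, 0 ≤ s → 0 ≤ lift c s := fun s hs => add_nonneg hs (bump_nonneg c s)
  have hbm : AEMeasurable (fun x => ENNReal.ofReal (bump c (v x))) (volume.restrict Ω) :=
    ((continuous_bump c).measurable.comp_aemeasurable hvm).ennreal_ofReal
  have hsum : potentialEnergy Ω (fun x => lift c (v x)) +
      ENNReal.ofReal (∫ x in Ω, bump c (v x)) =
      ∫⁻ x in Ω, ENNReal.ofReal ((∫ h in (1 : ℝ)..lift c (v x), Real.log h) + bump c (v x)) := by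
    rw [ofReal_integral_eq_lintegral_ofReal (integrableOn_bump hΩf hv hv0 hc)
      (Eventually.of_forall fun x => bump_nonneg _ _), potentialEnergy,
      ← lintegral_add_right' _ hbm]
    refine lintegral_congr_ae ?_
    filter_upwards [hv0] with x hx
    exact (ENNReal.ofReal_add (integral_log_one_nonneg (hlift0 _ hx)) (bump_nonneg _ _)).symm
  rw [hsum]
  have hle : ∀ᵐ x ∂(volume.restrict Ω),
      ENNReal.ofReal ((∫ h in (1 : ℝ)..lift c (v x), Real.log h) + bump c (v x)) ≤
        ENNReal.ofReal (∫ h in (1 : ℝ)..v x, Real.log h) := by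
    filter_upwards [hv0] with x hx
    exact ENNReal.ofReal_le_ofReal (integral_log_lift_le hx)
  refine lintegral_strict_mono_of_ae_le_of_ae_lt_on (hL.comp_aemeasurable hvm).ennreal_ofReal
    ((lintegral_mono_ae hle).trans_lt hP.lt_top).ne hle (s := {x | ¬ c ≤ v x}) hlt ?_
  filter_upwards [hv0] with x hx hxc
  have hxc' : v x < c := not_le.1 hxc
  have h1 := integral_log_lift_lt hx hxc'
  refine (ENNReal.ofReal_lt_ofReal_iff ?_).2 h1
  linarith [bump_nonneg c (v x), integral_log_one_nonneg (hlift0 _ hx)]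

theorem IsMinimiser.exp_neg_one_le (hn : 1 ≤ n) {Ω : Set (E n)} (hΩo : IsOpen Ω)
    (hΩb : Bornology.IsBounded Ω) (hΩL : HasLipschitzBoundary Ω) {β : E n → ℝ}
    (hβ : MemLp β ⊤ (surfaceMeasure Ω)) (hβ0 : ∀ᵐ x ∂(surfaceMeasure Ω), β x ≤ 0) {v : E n → ℝ}
    (hv : IsMinimiser Ω β v) : ∀ᵐ x ∂(volume.restrict Ω), Real.exp (-1) ≤ v x := by
  obtain ⟨⟨hvBV, hv0⟩, hmin⟩ := hv
  have hvi : IntegrableOn v Ω := hvBV.1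
  have hΩf : volume Ω ≠ ⊤ := hΩb.measure_lt_top.ne
  by_contra hlt
  have hc : Real.exp (-1) ≤ 1 := Real.exp_le_one_iff.2 (by norm_num)
  have hS : surfaceEnergy Ω v ≠ ⊤ := ((mem_BV_iff_surfaceEnergy_lt_top hΩf hvi).1 hvBV).ne
  have hS0 : surfaceEnergy Ω v ≠ ⊥ := (EReal.bot_lt_zero.trans_le (surfaceEnergy_nonneg Ω v)).ne'
  -- Membership in `BV` alone does not bound the potential; minimality against the zero function
  -- does. Finiteness is needed for the strict inequality to survive.
  have hP : potentialEnergy Ω v ≠ ⊤ := by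
    intro hP
    obtain ⟨h0, h1⟩ := zero_mem_BVplus_and_J1_lt_top hΩf β
    refine ((hmin _ h0).trans_lt h1).ne ?_
    rw [J1, hP, EReal.coe_ennreal_top, EReal.add_top_of_ne_bot hS0, EReal.top_add_coe]
  have hI0 : 0 ≤ ∫ x in Ω, bump (Real.exp (-1)) (v x) :=
    integral_nonneg fun x => bump_nonneg _ _
  have hwi : IntegrableOn (fun x => lift (Real.exp (-1)) (v x)) Ω :=
    hvi.add (integrableOn_bump hΩf hvi hv0 hc)
  have hSw := surfaceEnergy_lift_le hΩo hΩf hvi hv0 hc (EReal.coe_toReal hS hS0).ge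
  have hPw := potentialEnergy_lift_add_lt hΩf hvi hv0 hP hlt
  have hWw := wettingEnergy_lift_le hn hΩo hΩb hΩL hβ hβ0 hvi hv0 hc hwi
  have hw : (fun x => lift (Real.exp (-1)) (v x)) ∈ BVplus Ω := by
    refine ⟨(mem_BV_iff_surfaceEnergy_lt_top hΩf hwi).2 (hSw.trans_lt (EReal.coe_lt_top _)), ?_⟩
    filter_upwards [hv0] with x hx
    exact add_nonneg hx (bump_nonneg _ _)
  have hJ := hmin _ hw
  have hPw' : potentialEnergy Ω (fun x => lift (Real.exp (-1)) (v x)) ≠ ⊤ :=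
    ((le_self_add.trans_lt hPw).trans hP.lt_top).ne
  have hPr := (ENNReal.toReal_lt_toReal
    (ENNReal.add_ne_top.2 ⟨hPw', ENNReal.ofReal_ne_top⟩) hP).2 hPw
  rw [ENNReal.toReal_add hPw' ENNReal.ofReal_ne_top, ENNReal.toReal_ofReal hI0] at hPr
  -- All terms are finite, so the inequality can be read in `ℝ`; the surface gain `∫ bump` is
  -- strictly outweighed by the potential drop `hPr`.
  have hJ' := hJ.trans (add_le_add (add_le_add hSw le_rfl) (EReal.coe_le_coe_iff.2 hWw))
  rw [J1, ← EReal.coe_toReal hS hS0, ← EReal.coe_ennreal_toReal hP,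
    ← EReal.coe_ennreal_toReal hPw'] at hJ'
  simp only [← EReal.coe_add, EReal.coe_le_coe_iff, EReal.toReal_coe] at hJ'
  linarith

end Capillarity

theorem mainTheorem6 (n : ℕ) (hn : 1 ≤ n)
    (Ω : Set (Capillarity.E n)) (hΩo : IsOpen Ω) (hΩb : Bornology.IsBounded Ω)
    (hΩL : Capillarity.HasLipschitzBoundary Ω)
    (β : Capillarity.E n → ℝ)
    (hβ : MemLp β ⊤ (Capillarity.surfaceMeasure Ω))
    (hβ0 : ∀ᵐ x ∂(Capillarity.surfaceMeasure Ω), β x ≤ 0)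
    (v : Capillarity.E n → ℝ) (hv : Capillarity.IsMinimiser Ω β v) :
    ∀ᵐ x ∂(volume.restrict Ω), Real.exp (-1) ≤ v x :=
  hv.exp_neg_one_le hn hΩo hΩb hΩL hβ hβ0
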